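/- **Setting.** Let $n\ge 1$, let $d\gamma(x)=\pi^{-n/2}e^{-|x|^2}\,dx$ be the Gauss measure on $\mathbb R^n$, and let $m(x)=\min\{1,1/|x|\}$ (with $m(0)=1$). Balls $B=B(c_B,r_B)$ are open, with $r_B>0$. For $a>0$ let $\mathcal B_a$ be the set of balls $B$ with $r_B\le a\,m(c_B)$, and write $f_B=\frac1{\gamma(B)}\int_B f\,d\gamma$. For $a>0$ and $\beta\in(0,1)$ define $$I_a^\beta f(x)=\int_{B(x,am(x))}\frac{f(y)}{V(x,y)^{1-\beta}}\,d\gamma(y),\qquad \widetilde I_a^\beta f(x)=\int_{B(x,am(x))}\frac{f(y)}{[e^{-|x|^2}|x-y|^n]^{1-\beta}}\,d\gamma(y),$$ where $V(x,y)=\gamma(B(x,|x-y|))$. **Hardy space.** For $r\in(1,\infty)$, a $(1,r)$-atom is either the constant function $1$ or a function $b\in L^1(\gamma)$ supported in some $B\in\mathcal B_1$ with $\|b\|_{L^r(\gamma)}\le\gamma(B)^{1/r-1}$ and $\int_B b\,d\gamma=0$. The space $H^{1,r}(\gamma)$ consists of the $g\in L^1(\gamma)$ of the form $g=\sum_k\lambda_kb_k$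 (convergence in $L^1(\gamma)$) with $(1,r)$-atoms $b_k$ and $\lambda_k\in\mathbb C$, $\sum_k|\lambda_k|<\infty$; its norm is the infimum of $\sum_k|\lambda_k|$ over all such representations. (These spaces coincide for all $r\in(1,\infty)$, with equivalent norms; the common space is denoted $H^1(\gamma)$.) **BMO and BLO.** $\mathrm{BMO}(\gamma)$ is the space of $f\in L^1(\gamma)$ with $$\|f\|_{\mathrm{BMO}(\gamma)}=\|f\|_{L^1(\gamma)}+\sup_{B\in\mathcal B_1}\frac1{\gamma(B)}\int_B|f-f_B|\,d\gamma<\infty,$$ and $\mathrm{BLO}_a(\gamma)$ is the set of real locally integrable $f$ with $$\|f\|_{\mathrm{BLO}_a(\gamma)}=\|f\|_{L^1(\gamma)}+\sup_{B\in\mathcal B_a}\Big[f_B-\operatorname*{ess\,inf}_{B}f\Big]<\infty.$$ **Theorem 3.2.** Let $a\in(0,\infty)$, $\beta\in(0,1)$, and let $T$ be $I_a^\beta$ or $\widetilde I_a^\beta$. For every $f$ in each of the spaces below, the integral defining $Tf(x)$ converges absolutely for almost every $x$, and: (i) $T$ is bounded from $H^1(\gamma)$ to $L^{1/(1-\beta)}(\gamma)$: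 for every $r\in(1,\infty)$ there is a constant $C$, depending only on $n,a,\beta,r$, such that $Tf\in L^{1/(1-\beta)}(\gamma)$ and $\|Tf\|_{L^{1/(1-\beta)}(\gamma)}\le C\|f\|_{H^{1,r}(\gamma)}$ for all $f\in H^{1,r}(\gamma)$; (ii) there is a constant $C$, depending only on $n,a,\beta$, such that for all real $f\in L^{1/\beta}(\gamma)$ with $f\ge0$ a.e., $Tf\in\mathrm{BLO}_a(\gamma)$ and $\|Tf\|_{\mathrm{BLO}_a(\gamma)}\le C\|f\|_{L^{1/\beta}(\gamma)}$; (iii) there is a constant $C$, depending only on $n,a,\beta$, such that for all complex-valued $f\in L^{1/\beta}(\gamma)$, $Tf\in\mathrm{BMO}(\gamma)$ and $\|Tf\|_{\mathrm{BMO}(\gamma)}\le C\|f\|_{L^{1/\beta}(\gamma)}$. -/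

import Mathlib

open MeasureTheory Filter Topology
open scoped ENNReal NNReal

noncomputable section

namespace GaussFrac

/-- Euclidean space `ℝⁿ` with its Euclidean norm. -/
abbrev E (n : ℕ) : Type := EuclideanSpace ℝ (Fin n)

/-- The Gauss measure `dγ(x) = π^{-n/2} e^{-|x|²} dx` on `ℝⁿ`. -/
def gauss (n : ℕ) : Measure (E n) :=
  (volume : Measure (E n)).withDensity
    (fun x => ENNReal.ofReal (Real.pi ^ (-(n : ℝ) / 2) * Real.exp (-‖x‖ ^ 2)))

/-- The function `m(x) = min {1, 1/|x|}` (so `m(0) = 1`), written as `1 / max {1, |x|}`. -/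
def m {n : ℕ} (x : E n) : ℝ := (max 1 ‖x‖)⁻¹

theorem m_zero {n : ℕ} : m (0 : E n) = 1 := by simp [m]

theorem m_eq_min {n : ℕ} {x : E n} (hx : x ≠ 0) : m x = min 1 (1 / ‖x‖) := by
  have h0 : 0 < ‖x‖ := norm_pos_iff.mpr hx
  unfold m
  rcases le_total 1 ‖x‖ with h | h
  · rw [max_eq_right h, min_eq_right, one_div]
    rw [one_div]
    exact inv_le_one_of_one_le₀ h
  · rw [max_eq_left h, min_eq_left, inv_one]
    rw [one_div]
    exact (one_le_inv₀ h0).mpr h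

/-- The open ball `B(c, r)` belongs to the admissible class `𝓑_a`: `0 < r ≤ a m(c)`. -/
def Admissible {n : ℕ} (a : ℝ) (c : E n) (r : ℝ) : Prop := 0 < r ∧ r ≤ a * m c

/-- `V(x, y) = γ(B(x, |x - y|))`. -/
def V {n : ℕ} (x y : E n) : ℝ := (gauss n).real (Metric.ball x ‖x - y‖)

/-- The kernel `1 / V(x, y)^{1-β}` of `I_a^β`. -/
def kernelI {n : ℕ} (β : ℝ) (x y : E n) : ℝ := 1 / V x y ^ (1 - β)

/-- The kernel `1 / (e^{-|x|²} |x - y|ⁿ)^{1-β}` of `Ĩ_a^β`. -/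
def kernelITilde {n : ℕ} (β : ℝ) (x y : E n) : ℝ :=
  1 / (Real.exp (-‖x‖ ^ 2) * ‖x - y‖ ^ n) ^ (1 - β)

/-- The local integral operator `f ↦ ∫_{B(x, a m(x))} K(x, y) f(y) dγ(y)`. With `K = kernelI β`
this is `I_a^β`, with `K = kernelITilde β` it is `Ĩ_a^β`. -/
def localOp {n : ℕ} {F : Type*} [NormedAddCommGroup F] [NormedSpace ℝ F]
    (a : ℝ) (K : E n → E n → ℝ) (f : E n → F) (x : E n) : F :=
  ∫ y in Metric.ball x (a * m x), K x y • f y ∂(gauss n)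

/-- The integral defining `localOp a K f x` converges absolutely for almost every `x`. -/
def LocalOpConverges {n : ℕ} {F : Type*} [NormedAddCommGroup F] [NormedSpace ℝ F]
    (a : ℝ) (K : E n → E n → ℝ) (f : E n → F) : Prop :=
  ∀ᵐ x ∂(gauss n), IntegrableOn (fun y => K x y • f y) (Metric.ball x (a * m x)) (gauss n)

/-- `(1, r)` atoms: the constant function `1`, or a function in `L¹(γ)` supported in a ball
`B ∈ 𝓑_1` with `‖b‖_{L^r(γ)} ≤ γ(B)^{1/r - 1}` and `∫_B b dγ = 0`
(functions are understood up to `γ`-null sets). -/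
def IsAtom {n : ℕ} (r : ℝ) (b : E n → ℂ) : Prop :=
  b =ᵐ[gauss n] (fun _ => 1) ∨
  (Integrable b (gauss n) ∧ ∃ (c : E n) (ρ : ℝ), Admissible 1 c ρ ∧
    (∀ᵐ x ∂(gauss n), x ∉ Metric.ball c ρ → b x = 0) ∧
    eLpNorm b (ENNReal.ofReal r) (gauss n) ≤ gauss n (Metric.ball c ρ) ^ (1 / r - 1) ∧
    ∫ x in Metric.ball c ρ, b x ∂(gauss n) = 0)

/-- `g = ∑ₖ λₖ bₖ` with `(1, r)` atoms `bₖ` and `∑ₖ |λₖ| < ∞`, the series converging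
in `L¹(γ)`. -/
def IsAtomicDecomposition {n : ℕ} (r : ℝ) (g : E n → ℂ) (lam : ℕ → ℂ) (b : ℕ → E n → ℂ) : Prop :=
  (∀ k, IsAtom r (b k)) ∧ Summable (fun k => ‖lam k‖) ∧
  Tendsto (fun N => eLpNorm (fun x => g x - ∑ k ∈ Finset.range N, lam k * b k x) 1 (gauss n))
    atTop (𝓝 0)

/-- Membership in the atomic Hardy space `H^{1,r}(γ)`. -/
def MemH1 {n : ℕ} (r : ℝ) (g : E n → ℂ) : Prop :=
  Integrable g (gauss n) ∧ ∃ lam b, IsAtomicDecomposition r g lam b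

/-- The norm of `H^{1,r}(γ)`: the infimum of `∑ₖ |λₖ|` over all atomic decompositions. -/
def h1Norm {n : ℕ} (r : ℝ) (g : E n → ℂ) : ℝ≥0∞ :=
  ⨅ (lam : ℕ → ℂ) (b : ℕ → E n → ℂ) (_ : IsAtomicDecomposition r g lam b), ∑' k, ‖lam k‖ₑ

/-- The `BMO(γ)` norm `‖f‖_{L¹(γ)} + sup_{B ∈ 𝓑_1} γ(B)⁻¹ ∫_B |f - f_B| dγ`. -/
def bmoNorm {n : ℕ} (f : E n → ℂ) : ℝ≥0∞ :=
  eLpNorm f 1 (gauss n) +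
  ⨆ (c : E n) (r : ℝ) (_ : Admissible 1 c r),
    ⨍⁻ x in Metric.ball c r, ‖f x - ⨍ y in Metric.ball c r, f y ∂(gauss n)‖ₑ ∂(gauss n)

/-- Membership in `BMO(γ)`. -/
def MemBMO {n : ℕ} (f : E n → ℂ) : Prop := Integrable f (gauss n) ∧ bmoNorm f < ∞

/-- The `BLO_a(γ)` norm `‖f‖_{L¹(γ)} + sup_{B ∈ 𝓑_a} [f_B - essinf_B f]`. The essential infimum is
taken in the extended reals, so it is `-∞` when `f` is not essentially bounded below on `B`, and the
bracket is then `∞`. For integrable `f` the bracket is nonnegative. -/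
def bloNorm {n : ℕ} (a : ℝ) (f : E n → ℝ) : ℝ≥0∞ :=
  eLpNorm f 1 (gauss n) +
  ⨆ (c : E n) (r : ℝ) (_ : Admissible a c r),
    (((⨍ x in Metric.ball c r, f x ∂(gauss n) : ℝ) : EReal) -
      essInf (fun x => (f x : EReal)) ((gauss n).restrict (Metric.ball c r))).toENNReal

/-- Membership in `BLO_a(γ)`. -/
def MemBLO {n : ℕ} (a : ℝ) (f : E n → ℝ) : Prop :=
  LocallyIntegrable f (gauss n) ∧ bloNorm a f < ∞

end GaussFrac

end

noncomputable section

namespace GaussFrac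

variable {n : ℕ}

/-! On a ball of radius at most `A * m c` about `c`, the exponent `|x|²` varies by at most a
constant depending on `A`, because `‖c‖ * m c ≤ 1`. There the Gauss measure is `wt c` times Lebesgue
measure up to constants, and `γ(B(c, r))` is comparable to `wt c * r ^ n`. Both operators see only
such balls, so they behave like fractional integrals of order `β`, with the doubling property
available at every scale that occurs.

The argument uses only the axioms `FracKernel`: `k` lives near the diagonal, `k x y` is at most a
multiple of `(wt c * dist x y ^ n) ^ (-(1 - β))`, and moving one variable inside `B(c, r)` while the
other stays outside `9B` changes `k` by a Hörmander-type term plus a term at scale `m c` caused by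
the cut-off. Two consequences carry the theorem. First, `k ^ s` is integrable over `B(c, R)`, with
bound a power of `wt c * R ^ n`, whenever `s * (1 - β) < 1` (`exists_lintegral_rpow_le`). Second,
the oscillation `k x · - k x' ·` is bounded in `L^{1/(1-β)}` off `9B`, uniformly in the ball
(`exists_lintegral_osc_le`).

For `f` in `L^{1/β}`, the far part of `Tf(x) - Tf(x')` is controlled by Hölder, `1/β` and `1/(1-β)`
being conjugate, and the near part is controlled on average. Averaging in both points gives BMO. For
`f ≥ 0` the near part at `x'` may be discarded, so averaging in `x` alone bounds `Tf` from below at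
almost every `x'`, which is BLO.

For an atom, cancellation and the oscillation bound handle the complement of `9B`; inside `9B` two
applications of Hölder use `r > 1` to replace the borderline exponent `1/(1-β)` by a smaller one.
Since `T` is bounded on `L¹`, Fatou's lemma passes from atoms to all of `H¹`.

Finally both kernels are `W ^ (-(1 - β))`, cut off at `a * m x`, for a function `W` that is bounded
below by a multiple of `wt x * dist x y ^ n` and varies slowly off the diagonal (`LocalVolume`). -/

/-! ### The Gauss measure on balls of admissible size -/

/-- The unnormalised Gaussian density. -/
def wt (x : E n) : ℝ := Real.exp (-‖x‖ ^ 2)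

theorem wt_pos (x : E n) : 0 < wt x := Real.exp_pos _

theorem wt_le_one (x : E n) : wt x ≤ 1 := Real.exp_le_one_iff.mpr (by nlinarith [sq_nonneg ‖x‖])

theorem measurable_wt : Measurable (wt : E n → ℝ) := by unfold wt; fun_prop

theorem m_pos (x : E n) : 0 < m x := inv_pos.mpr (lt_max_of_lt_left one_pos)

theorem m_le_one (x : E n) : m x ≤ 1 := inv_le_one_of_one_le₀ (le_max_left _ _)

theorem measurable_m : Measurable (m : E n → ℝ) := by unfold m; fun_prop

theorem norm_mul_m_le (x : E n) : ‖x‖ * m x ≤ 1 := by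
  have h : 0 < max 1 ‖x‖ := lt_max_of_lt_left one_pos
  rw [m, ← div_eq_mul_inv, div_le_one h]
  exact le_max_right _ _

/-- `1 / m` is `max 1 ‖·‖`, which grows by at most the displacement, and the displacement is at most
`A`, hence at most `A` times that maximum. -/
theorem m_le_of_dist {A : ℝ} {x y : E n} (hA : 0 ≤ A) (h : dist x y ≤ A * m x) :
    m x ≤ (1 + A) * m y := by
  have hx : 0 < max 1 ‖x‖ := lt_max_of_lt_left one_pos
  have hy : 0 < max 1 ‖y‖ := lt_max_of_lt_left one_pos
  have h1 : ‖y‖ ≤ ‖x‖ + dist x y := by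
    rw [dist_comm, dist_eq_norm]; linarith [norm_sub_norm_le y x]
  have h2 : A * m x ≤ A * max 1 ‖x‖ := by
    have := m_le_one x
    gcongr
    exact this.trans (le_max_left _ _)
  have h3 : max 1 ‖y‖ ≤ (1 + A) * max 1 ‖x‖ := by
    apply max_le
    · nlinarith [le_max_left 1 ‖x‖, mul_nonneg hA hx.le]
    · nlinarith [le_max_right 1 ‖x‖]
  unfold m
  rw [← div_eq_mul_inv, inv_eq_one_div, div_le_div_iff₀ hx hy]
  linarith

theorem m_le_of_dist' {A : ℝ} {x y : E n} (hA : 0 ≤ A) (h : dist x y ≤ A * m x) :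
    m y ≤ (1 + A) * m x := by
  have hx : 0 < max 1 ‖x‖ := lt_max_of_lt_left one_pos
  have hy : 0 < max 1 ‖y‖ := lt_max_of_lt_left one_pos
  have h1 : ‖x‖ ≤ ‖y‖ + dist x y := by
    rw [dist_eq_norm]; linarith [norm_sub_norm_le x y]
  have h2 : A * m x ≤ A * max 1 ‖y‖ := by
    have := m_le_one x
    gcongr
    exact this.trans (le_max_left _ _)
  have h3 : max 1 ‖x‖ ≤ (1 + A) * max 1 ‖y‖ := by
    apply max_le
    · nlinarith [le_max_left 1 ‖y‖, mul_nonneg hA hy.le]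
    · nlinarith [le_max_right 1 ‖y‖]
  unfold m
  rw [← div_eq_mul_inv, inv_eq_one_div, div_le_div_iff₀ hy hx]
  linarith

theorem abs_norm_sq_sub_le (x y : E n) :
    |‖x‖ ^ 2 - ‖y‖ ^ 2| ≤ dist x y * (2 * ‖x‖ + dist x y) := by
  have h1 : |‖x‖ - ‖y‖| ≤ dist x y := by rw [dist_eq_norm]; exact abs_norm_sub_norm_le x y
  have h2 : ‖y‖ ≤ ‖x‖ + dist x y := by linarith [(abs_le.mp h1).1]
  have h3 : ‖x‖ ^ 2 - ‖y‖ ^ 2 = (‖x‖ - ‖y‖) * (‖x‖ + ‖y‖) := by ring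
  rw [h3, abs_mul, abs_of_nonneg (by positivity : 0 ≤ ‖x‖ + ‖y‖)]
  exact mul_le_mul h1 (by linarith) (by positivity) dist_nonneg

/-- This is where the scale `m` matters: the dangerous product `‖x‖ * dist x y` is at most `A * (‖x‖
* m x) ≤ A`. -/
theorem abs_norm_sq_sub_le_of_dist {A : ℝ} {x y : E n} (hA : 0 ≤ A) (h : dist x y ≤ A * m x) :
    |‖x‖ ^ 2 - ‖y‖ ^ 2| ≤ 2 * A + A ^ 2 := by
  refine (abs_norm_sq_sub_le x y).trans ?_
  have hm := m_pos x
  have h1 := m_le_one x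
  have h2 := norm_mul_m_le x
  calc dist x y * (2 * ‖x‖ + dist x y) ≤ (A * m x) * (2 * ‖x‖ + A * m x) := by gcongr
    _ = 2 * A * (‖x‖ * m x) + A ^ 2 * (m x * m x) := by ring
    _ ≤ 2 * A * 1 + A ^ 2 * (1 * 1) := by gcongr
    _ = _ := by ring

/-- The oscillation constant of the Gaussian density on balls of the class `𝓑_A`. -/
def wtConst (A : ℝ) : ℝ := Real.exp (2 * A + A ^ 2)

theorem wtConst_pos (A : ℝ) : 0 < wtConst A := Real.exp_pos _

theorem wt_le_of_dist {A : ℝ} {x y : E n} (hA : 0 ≤ A) (h : dist x y ≤ A * m x) :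
    wt x ≤ wtConst A * wt y := by
  have := abs_le.mp (abs_norm_sq_sub_le_of_dist hA h)
  rw [wt, wt, wtConst, ← Real.exp_add]
  exact Real.exp_le_exp.mpr (by linarith)

theorem wt_le_of_dist' {A : ℝ} {x y : E n} (hA : 0 ≤ A) (h : dist x y ≤ A * m x) :
    wt y ≤ wtConst A * wt x := by
  have := abs_le.mp (abs_norm_sq_sub_le_of_dist hA h)
  rw [wt, wt, wtConst, ← Real.exp_add]
  exact Real.exp_le_exp.mpr (by linarith)

/-- The normalising constant of the Gauss measure. -/
def gaussConst (n : ℕ) : ℝ := Real.pi ^ (-(n : ℝ) / 2)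

theorem gaussConst_pos (n : ℕ) : 0 < gaussConst n := Real.rpow_pos_of_pos Real.pi_pos _

theorem gauss_eq : gauss n = (volume : Measure (E n)).withDensity
    (fun x => ENNReal.ofReal (gaussConst n * wt x)) := rfl

theorem restrict_gauss_le {A : ℝ} (hA : 0 ≤ A) {c : E n} {S : Set (E n)} (hS : MeasurableSet S)
    (hSc : S ⊆ Metric.closedBall c (A * m c)) :
    (gauss n).restrict S ≤
      ENNReal.ofReal (gaussConst n * wtConst A * wt c) • (volume.restrict S) := by
  rw [gauss_eq, restrict_withDensity hS, ← withDensity_const]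
  apply withDensity_mono
  filter_upwards [ae_restrict_mem hS] with x hx
  apply ENNReal.ofReal_le_ofReal
  have : wt x ≤ wtConst A * wt c := wt_le_of_dist' hA (by rw [dist_comm]; exact hSc hx)
  rw [mul_assoc]
  exact mul_le_mul_of_nonneg_left this (gaussConst_pos n).le

theorem le_restrict_gauss {A : ℝ} (hA : 0 ≤ A) {c : E n} {S : Set (E n)} (hS : MeasurableSet S)
    (hSc : S ⊆ Metric.closedBall c (A * m c)) :
    ENNReal.ofReal (gaussConst n / wtConst A * wt c) • (volume.restrict S) ≤
      (gauss n).restrict S := by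
  rw [gauss_eq, restrict_withDensity hS, ← withDensity_const]
  apply withDensity_mono
  filter_upwards [ae_restrict_mem hS] with x hx
  apply ENNReal.ofReal_le_ofReal
  have : wt c ≤ wtConst A * wt x := wt_le_of_dist hA (by rw [dist_comm]; exact hSc hx)
  rw [div_mul_eq_mul_div, div_le_iff₀ (wtConst_pos A), mul_assoc, mul_comm (wt x)]
  exact mul_le_mul_of_nonneg_left this (gaussConst_pos n).le

theorem lintegral_gauss_le {A : ℝ} (hA : 0 ≤ A) {c : E n} {S : Set (E n)} (hS : MeasurableSet S)
    (hSc : S ⊆ Metric.closedBall c (A * m c)) (f : E n → ℝ≥0∞) :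
    ∫⁻ x in S, f x ∂(gauss n) ≤
      ENNReal.ofReal (gaussConst n * wtConst A * wt c) * ∫⁻ x in S, f x := by
  refine (lintegral_mono' (restrict_gauss_le hA hS hSc) le_rfl).trans ?_
  rw [lintegral_smul_measure, smul_eq_mul]

theorem gauss_le {A : ℝ} (hA : 0 ≤ A) {c : E n} {S : Set (E n)} (hS : MeasurableSet S)
    (hSc : S ⊆ Metric.closedBall c (A * m c)) :
    gauss n S ≤ ENNReal.ofReal (gaussConst n * wtConst A * wt c) * volume S := by
  simpa using lintegral_gauss_le hA hS hSc (fun _ => 1)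

theorem le_gauss {A : ℝ} (hA : 0 ≤ A) {c : E n} {S : Set (E n)} (hS : MeasurableSet S)
    (hSc : S ⊆ Metric.closedBall c (A * m c)) :
    ENNReal.ofReal (gaussConst n / wtConst A * wt c) * volume S ≤ gauss n S := by
  simpa using le_restrict_gauss hA hS hSc Set.univ

instance : IsFiniteMeasure (gauss n) := by
  apply isFiniteMeasure_withDensity_ofReal
  have h := GaussianFourier.integrable_cexp_neg_mul_sq_norm_add (V := E n) (b := 1) (by simp) 0 0
  refine (((h.norm).const_mul (gaussConst n)).congr ?_).2
  filter_upwards with x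
  simp [Complex.norm_exp, gaussConst, ← Complex.ofReal_pow]

/-- The volume of the unit ball. -/
def unitVol (n : ℕ) : ℝ := (volume : Measure (E n)).real (Metric.ball 0 1)

theorem unitVol_pos : 0 < unitVol n :=
  ENNReal.toReal_pos (Metric.measure_ball_pos _ _ one_pos).ne' measure_ball_lt_top.ne

theorem volume_ball_eq (c : E n) {r : ℝ} (hr : 0 < r) :
    volume (Metric.ball c r) = ENNReal.ofReal (r ^ n * unitVol n) := by
  rw [Measure.addHaar_ball_of_pos _ _ hr, finrank_euclideanSpace_fin,
    ENNReal.ofReal_mul (by positivity), unitVol, ofReal_measureReal measure_ball_lt_top.ne]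

theorem gauss_ball_le {A : ℝ} (hA : 0 ≤ A) {c : E n} {r : ℝ} (hr : 0 < r) (hrA : r ≤ A * m c) :
    gauss n (Metric.ball c r) ≤
      ENNReal.ofReal (gaussConst n * wtConst A * unitVol n * (wt c * r ^ n)) := by
  refine (gauss_le hA Metric.isOpen_ball.measurableSet
    (Metric.ball_subset_closedBall.trans (Metric.closedBall_subset_closedBall hrA))).trans ?_
  have := gaussConst_pos n
  have := wtConst_pos A
  have := wt_pos c
  rw [volume_ball_eq c hr, ← ENNReal.ofReal_mul (by positivity)]
  exact ENNReal.ofReal_le_ofReal (by ring_nf; rfl)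

theorem le_gauss_ball {A : ℝ} (hA : 0 ≤ A) {c : E n} {r : ℝ} (hr : 0 < r) (hrA : r ≤ A * m c) :
    ENNReal.ofReal (gaussConst n / wtConst A * unitVol n * (wt c * r ^ n)) ≤
      gauss n (Metric.ball c r) := by
  refine le_trans ?_ (le_gauss hA Metric.isOpen_ball.measurableSet
    (Metric.ball_subset_closedBall.trans (Metric.closedBall_subset_closedBall hrA)))
  have := gaussConst_pos n
  have := wtConst_pos A
  have := wt_pos c
  rw [volume_ball_eq c hr, ← ENNReal.ofReal_mul (by positivity)]
  exact ENNReal.ofReal_le_ofReal (by ring_nf; rfl)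

/-- Only the annulus is compared with Lebesgue measure, so the inner ball keeps the coefficient one.
The regularity of `V` needs a factor `1 + O(η)`, which plain comparability would not give. -/
theorem gauss_ball_le_add {A : ℝ} (hA : 0 ≤ A) {c : E n} {s t : ℝ} (ht : 0 < t) (hts : t ≤ s)
    (hs : s ≤ A * m c) :
    gauss n (Metric.ball c s) ≤ gauss n (Metric.ball c t) +
      ENNReal.ofReal (gaussConst n * wtConst A * unitVol n * (wt c * (s ^ n - t ^ n))) := by
  have hsub : Metric.ball c t ⊆ Metric.ball c s := Metric.ball_subset_ball hts
  have hm : MeasurableSet (Metric.ball c t) := Metric.isOpen_ball.measurableSet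
  have hun := measure_add_sdiff (μ := gauss n) hm.nullMeasurableSet (Metric.ball c s)
  rw [Set.union_eq_right.mpr hsub] at hun
  rw [← hun]
  gcongr
  refine (gauss_le hA (Metric.isOpen_ball.measurableSet.diff hm) (Set.sdiff_subset.trans
    (Metric.ball_subset_closedBall.trans (Metric.closedBall_subset_closedBall hs)))).trans ?_
  have := gaussConst_pos n
  have := wtConst_pos A
  have := wt_pos c
  have := unitVol_pos (n := n)
  rw [measure_sdiff hsub hm.nullMeasurableSet measure_ball_lt_top.ne, volume_ball_eq c ht,
    volume_ball_eq c (ht.trans_le hts), ← ENNReal.ofReal_sub _ (by positivity),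
    ← ENNReal.ofReal_mul (by positivity)]
  exact ENNReal.ofReal_le_ofReal (by ring_nf; rfl)

theorem gauss_ball_pos (c : E n) {r : ℝ} (hr : 0 < r) : 0 < gauss n (Metric.ball c r) := by
  have h := m_pos c
  have := wt_pos c
  have := gaussConst_pos n
  have := wtConst_pos (r / m c)
  have := unitVol_pos (n := n)
  -- Every ball belongs to some class `𝓑_A`; this is the least such `A`.
  refine lt_of_lt_of_le ?_ (le_gauss_ball (A := r / m c) (by positivity) hr
    (by rw [div_mul_cancel₀ _ h.ne']))
  rw [ENNReal.ofReal_pos]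
  positivity

/-! ### Integrals of powers of the distance, by scaling -/

theorem lintegral_comp_add_smul (c : E n) {R : ℝ} (hR : 0 < R) (f : E n → ℝ≥0∞) :
    ∫⁻ y, f y = ENNReal.ofReal (R ^ n) * ∫⁻ z, f (c + R • z) := by
  have h1 : ∫⁻ y, f y = ∫⁻ y, f (c + y) := (lintegral_add_left_eq_self f c).symm
  have he : MeasurableEmbedding (fun z : E n => R • z) :=
    (Homeomorph.smulOfNeZero R hR.ne').measurableEmbedding
  have h2 := he.lintegral_map (μ := volume) (fun y => f (c + y))
  rw [Measure.map_addHaar_smul _ hR.ne', lintegral_smul_measure, finrank_euclideanSpace_fin,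
    abs_of_pos (by positivity), smul_eq_mul] at h2
  rw [h1, ← h2, ← mul_assoc, ← ENNReal.ofReal_mul (by positivity),
    mul_inv_cancel₀ (by positivity), ENNReal.ofReal_one, one_mul]

theorem exists_lintegral_ball_dist_rpow_le (hn : 1 ≤ n) {θ : ℝ} (hθ : θ < 1) :
    ∃ C : ℝ, 0 < C ∧ ∀ (x : E n) (R : ℝ), 0 < R →
      ∫⁻ y in Metric.ball x R, ENNReal.ofReal ((dist x y ^ n) ^ (-θ)) ≤
        ENNReal.ofReal (C * (R ^ n) ^ (1 - θ)) := by
  have hint : IntegrableOn (fun z : E n => (‖z‖ ^ n) ^ (-θ)) (Metric.ball 0 1) := by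
    refine integrableOn_ball_of_norm_le_rpow (C := 1) (α := n * θ) ?_ ?_ ?_ ?_
    · simpa using hn
    · have : (0:ℝ) < n := by exact_mod_cast hn
      rw [finrank_euclideanSpace_fin]; nlinarith
    · filter_upwards with z
      rw [Real.norm_of_nonneg (by positivity), one_mul, ← Real.rpow_natCast, ← Real.rpow_mul
        (norm_nonneg _), mul_neg]
    · exact (by fun_prop : Measurable fun z : E n => (‖z‖ ^ n) ^ (-θ)).aestronglyMeasurable
  set J := ∫⁻ z in Metric.ball (0 : E n) 1, ENNReal.ofReal ((‖z‖ ^ n) ^ (-θ)) with hJ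
  have hJt : J ≠ ∞ := by
    rw [hJ, ← ofReal_integral_eq_lintegral_ofReal hint (ae_of_all _ fun z => by positivity)]
    exact ENNReal.ofReal_ne_top
  obtain ⟨j, hj0, hj⟩ : ∃ j : ℝ, 0 ≤ j ∧ J = ENNReal.ofReal j :=
    ⟨J.toReal, ENNReal.toReal_nonneg, (ENNReal.ofReal_toReal hJt).symm⟩
  -- Adding one makes the constant positive without a lower bound on the integral.
  refine ⟨j + 1, by positivity, fun x R hR => ?_⟩
  rw [← lintegral_indicator Metric.isOpen_ball.measurableSet,
    lintegral_comp_add_smul x hR]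
  have : ∀ z : E n, (Metric.ball x R).indicator
      (fun y => ENNReal.ofReal ((dist x y ^ n) ^ (-θ))) (x + R • z) =
      ENNReal.ofReal ((R ^ n) ^ (-θ)) *
        (Metric.ball (0 : E n) 1).indicator (fun z => ENNReal.ofReal ((‖z‖ ^ n) ^ (-θ))) z := by
    intro z
    have hd : dist x (x + R • z) = R * ‖z‖ := by
      rw [dist_self_add_right, norm_smul, Real.norm_of_nonneg hR.le]
    by_cases hz : ‖z‖ < 1
    · rw [Set.indicator_of_mem, Set.indicator_of_mem, hd, ← ENNReal.ofReal_mul (by positivity),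
        mul_pow, Real.mul_rpow (by positivity) (by positivity)]
      · simpa using hz
      · rw [Metric.mem_ball, dist_comm, hd]; nlinarith
    · rw [Set.indicator_of_notMem, Set.indicator_of_notMem, mul_zero]
      · simpa using hz
      · rw [Metric.mem_ball, dist_comm, hd]; nlinarith
  simp_rw [this]
  rw [lintegral_const_mul' _ _ ENNReal.ofReal_ne_top,
    lintegral_indicator Metric.isOpen_ball.measurableSet, ← hJ, ← mul_assoc,
    ← ENNReal.ofReal_mul (by positivity), hj,
    ← ENNReal.ofReal_mul (by positivity)]
  apply ENNReal.ofReal_le_ofReal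
  have h1 : R ^ n * (R ^ n) ^ (-θ) = (R ^ n) ^ (1 - θ) := by
    rw [sub_eq_add_neg, Real.rpow_add (by positivity), Real.rpow_one]
  rw [h1, mul_comm]
  gcongr
  linarith

/-- The integrand has degree `-n` jointly in `R` and `y`, so scaling removes `R`. At unit scale it
is `‖z‖ ^ (-(n + q))` off the unit ball, where `1 + ‖z‖ ≤ 2 * ‖z‖` yields the factor `2 ^ (n + q)`.
-/
theorem exists_lintegral_compl_ball_le {q : ℝ} (hq : 0 < q) :
    ∃ C : ℝ, 0 < C ∧ ∀ (c : E n) (R : ℝ), 0 < R →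
      ∫⁻ y in (Metric.ball c R)ᶜ, ENNReal.ofReal ((R / dist y c) ^ q * (dist y c ^ n)⁻¹) ≤
        ENNReal.ofReal C := by
  set J := ∫⁻ z : E n, ENNReal.ofReal ((1 + ‖z‖) ^ (-(n + q))) with hJ
  have hJt : J ≠ ∞ := by
    refine (finite_integral_one_add_norm ?_).ne
    rw [finrank_euclideanSpace_fin]; linarith
  obtain ⟨j, hj0, hj⟩ : ∃ j : ℝ, 0 ≤ j ∧ J = ENNReal.ofReal j :=
    ⟨J.toReal, ENNReal.toReal_nonneg, (ENNReal.ofReal_toReal hJt).symm⟩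
  refine ⟨2 ^ (n + q) * (j + 1), by positivity, fun c R hR => ?_⟩
  rw [← lintegral_indicator Metric.isOpen_ball.measurableSet.compl,
    lintegral_comp_add_smul c hR]
  have : ∀ z : E n, (Metric.ball c R)ᶜ.indicator
      (fun y => ENNReal.ofReal ((R / dist y c) ^ q * (dist y c ^ n)⁻¹)) (c + R • z) ≤
      ENNReal.ofReal ((R ^ n)⁻¹ * 2 ^ (n + q)) * ENNReal.ofReal ((1 + ‖z‖) ^ (-(n + q))) := by
    intro z
    have hd : dist (c + R • z) c = R * ‖z‖ := by
      rw [dist_self_add_left, norm_smul, Real.norm_of_nonneg hR.le]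
    by_cases hz : 1 ≤ ‖z‖
    · have hz0 : 0 < ‖z‖ := by linarith
      rw [Set.indicator_of_mem, hd, ← ENNReal.ofReal_mul (by positivity)]
      · apply ENNReal.ofReal_le_ofReal
        have e1 : R / (R * ‖z‖) = ‖z‖⁻¹ := by field_simp
        have e2 : (1 + ‖z‖) ^ (-(n + q)) ≥ 2 ^ (-(n + q)) * ‖z‖ ^ (-(n + q)) := by
          rw [← Real.mul_rpow (by norm_num) hz0.le]
          apply Real.rpow_le_rpow_of_nonpos (by positivity) (by linarith)
          have : (0:ℝ) ≤ n := by positivity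
          linarith
        have e3 : ‖z‖ ^ (-(n + q)) = ‖z‖⁻¹ ^ q * (‖z‖ ^ n)⁻¹ := by
          rw [Real.rpow_neg hz0.le, Real.rpow_add hz0, Real.rpow_natCast, Real.inv_rpow hz0.le,
            mul_inv, mul_comm]
        have e4 : (2 : ℝ) ^ (n + q) * 2 ^ (-(n + q)) = 1 := by
          rw [← Real.rpow_add (by norm_num), add_neg_cancel, Real.rpow_zero]
        calc _ = (R ^ n)⁻¹ * (2 ^ (n + q) * 2 ^ (-(n + q))) * (‖z‖⁻¹ ^ q * (‖z‖ ^ n)⁻¹) := by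
              rw [e1, e4, mul_pow, mul_inv]; ring
          _ = (R ^ n)⁻¹ * 2 ^ (n + q) * (2 ^ (-(n + q)) * ‖z‖ ^ (-(n + q))) := by rw [e3]; ring
          _ ≤ _ := by gcongr
      · rw [Set.mem_compl_iff, Metric.mem_ball, hd]; nlinarith
    · rw [Set.indicator_of_notMem]
      · exact zero_le
      · rw [Set.mem_compl_iff, Metric.mem_ball, hd]; push Not at hz ⊢; nlinarith
  refine (mul_le_mul_right (lintegral_mono this) _).trans ?_
  rw [lintegral_const_mul' _ _ ENNReal.ofReal_ne_top, ← hJ, hj,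
    ← ENNReal.ofReal_mul (by positivity), ← ENNReal.ofReal_mul (by positivity)]
  apply ENNReal.ofReal_le_ofReal
  have : R ^ n * ((R ^ n)⁻¹ * 2 ^ (n + q) * j) = 2 ^ (n + q) * j := by
    field_simp
  rw [this]
  gcongr
  linarith

/-! ### Fractional kernels and their integral bounds -/

/-- Local kernels of fractional order `β`: kernels supported near the diagonal at the scale `m`,
with the size and the oscillation of `(e^{-|c|²} |x - y|ⁿ)^{-(1-β)}`. -/
structure FracKernel (β : ℝ) (k : E n → E n → ℝ) : Prop where
  measurable : Measurable (Function.uncurry k)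
  nonneg : ∀ x y, 0 ≤ k x y
  supp : ∃ A, 0 < A ∧ ∀ x y, k x y ≠ 0 → dist x y < A * m x ∧ dist x y < A * m y
  size : ∀ A, 0 < A → ∃ C, 0 < C ∧ ∀ c x y : E n, dist x c ≤ A * m c → dist y c ≤ A * m c →
    k x y ≤ C * (wt c * dist x y ^ n) ^ (-(1 - β))
  osc_left : ∀ A, 0 < A → ∃ C, 0 < C ∧ ∀ (c : E n) (r : ℝ), 0 < r → r ≤ A * m c → ∀ x x' y,
    dist x c < r → dist x' c < r → 9 * r ≤ dist y c →
    |k x y - k x' y| ≤ C * (wt c ^ (-(1 - β)) *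
      (r / dist y c * (dist y c ^ n) ^ (-(1 - β)) + (m c ^ n) ^ (-(1 - β))))
  osc_right : ∀ A, 0 < A → ∃ C, 0 < C ∧ ∀ (c : E n) (r : ℝ), 0 < r → r ≤ A * m c → ∀ x x' y,
    dist x c < r → dist x' c < r → 9 * r ≤ dist y c →
    |k y x - k y x'| ≤ C * (wt c ^ (-(1 - β)) *
      (r / dist y c * (dist y c ^ n) ^ (-(1 - β)) + (m c ^ n) ^ (-(1 - β))))

namespace FracKernel

variable {β : ℝ} {k : E n → E n → ℝ}

theorem swap (hk : FracKernel β k) : FracKernel β (fun x y => k y x) where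
  measurable := hk.measurable.comp measurable_swap
  nonneg x y := hk.nonneg y x
  supp := by
    obtain ⟨A, hA, h⟩ := hk.supp
    refine ⟨A, hA, fun x y hxy => ?_⟩
    rw [dist_comm]
    exact (h y x hxy).symm
  size A hA := by
    obtain ⟨C, hC, h⟩ := hk.size A hA
    refine ⟨C, hC, fun c x y hx hy => ?_⟩
    rw [dist_comm]
    exact h c y x hy hx
  osc_left := hk.osc_right
  osc_right := hk.osc_left

theorem measurable_right (hk : FracKernel β k) (x : E n) : Measurable (k x) :=
  hk.measurable.comp measurable_prodMk_left

theorem measurable_ofReal (hk : FracKernel β k) :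
    Measurable (Function.uncurry fun x y => ENNReal.ofReal (k x y)) :=
  hk.measurable.ennreal_ofReal

/-- The weight enters once from the measure and with power `-s * (1 - β)` from the kernel, exactly
as `R ^ n` does, so the bound is a power of the quantity comparable to `γ(B(c, R))`. The condition
on `s` is integrability of the singularity. -/
theorem exists_lintegral_rpow_le (hn : 1 ≤ n) (hk : FracKernel β k)
    {A : ℝ} (hA : 0 < A) {s : ℝ} (hs0 : 0 ≤ s) (hs : s * (1 - β) < 1) :
    ∃ C : ℝ, 0 < C ∧ ∀ (c : E n) (R : ℝ), 0 < R → R ≤ A * m c → ∀ x ∈ Metric.ball c R,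
      ∫⁻ y in Metric.ball c R, ENNReal.ofReal (k x y) ^ s ∂(gauss n) ≤
        ENNReal.ofReal (C * (wt c * R ^ n) ^ (1 - s * (1 - β))) := by
  obtain ⟨C₁, hC₁, h₁⟩ := hk.size A hA
  obtain ⟨C₂, hC₂, h₂⟩ := exists_lintegral_ball_dist_rpow_le hn hs
  have hg := gaussConst_pos n
  have hw := wtConst_pos A
  refine ⟨gaussConst n * wtConst A * C₁ ^ s * C₂ * ((2 : ℝ) ^ n) ^ (1 - s * (1 - β)),
    by positivity, fun c R hR hRA x hx => ?_⟩
  have hwc := wt_pos c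
  have hsub : Metric.ball c R ⊆ Metric.closedBall c (A * m c) :=
    Metric.ball_subset_closedBall.trans (Metric.closedBall_subset_closedBall hRA)
  have hsub2 : Metric.ball c R ⊆ Metric.ball x (2 * R) := by
    apply Metric.ball_subset_ball'
    rw [dist_comm]
    linarith [Metric.mem_ball.mp hx]
  have hpt : ∀ y ∈ Metric.ball c R, ENNReal.ofReal (k x y) ^ s ≤
      ENNReal.ofReal (C₁ ^ s * wt c ^ (-(s * (1 - β)))) *
        ENNReal.ofReal ((dist x y ^ n) ^ (-(s * (1 - β)))) := by
    intro y hy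
    rw [ENNReal.ofReal_rpow_of_nonneg (hk.nonneg _ _) hs0, ← ENNReal.ofReal_mul (by positivity)]
    apply ENNReal.ofReal_le_ofReal
    refine (Real.rpow_le_rpow (hk.nonneg _ _) (h₁ c x y (hsub hx) (hsub hy)) hs0).trans_eq ?_
    rw [Real.mul_rpow hC₁.le (by positivity), ← Real.rpow_mul (by positivity),
      Real.mul_rpow hwc.le (by positivity), mul_assoc]
    ring_nf
  calc ∫⁻ y in Metric.ball c R, ENNReal.ofReal (k x y) ^ s ∂(gauss n)
      ≤ ENNReal.ofReal (gaussConst n * wtConst A * wt c) *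
        ∫⁻ y in Metric.ball c R, ENNReal.ofReal (k x y) ^ s :=
        lintegral_gauss_le hA.le Metric.isOpen_ball.measurableSet hsub _
    _ ≤ ENNReal.ofReal (gaussConst n * wtConst A * wt c) *
        ∫⁻ y in Metric.ball c R, ENNReal.ofReal (C₁ ^ s * wt c ^ (-(s * (1 - β)))) *
        ENNReal.ofReal ((dist x y ^ n) ^ (-(s * (1 - β)))) := by
        gcongr 1
        exact setLIntegral_mono' Metric.isOpen_ball.measurableSet hpt
    _ ≤ ENNReal.ofReal (gaussConst n * wtConst A * wt c) *
        (ENNReal.ofReal (C₁ ^ s * wt c ^ (-(s * (1 - β)))) *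
          ENNReal.ofReal (C₂ * ((2 * R) ^ n) ^ (1 - s * (1 - β)))) := by
        rw [lintegral_const_mul' _ _ ENNReal.ofReal_ne_top]
        gcongr
        exact (lintegral_mono_set hsub2).trans (h₂ x (2 * R) (by linarith))
    _ = _ := by
        rw [← ENNReal.ofReal_mul (by positivity), ← ENNReal.ofReal_mul (by positivity), mul_pow,
          Real.mul_rpow (by positivity) (by positivity),
          Real.mul_rpow (by positivity) (by positivity)]
        have : wt c * wt c ^ (-(s * (1 - β))) = wt c ^ (1 - s * (1 - β)) := by
          rw [show 1 - s * (1 - β) = 1 + -(s * (1 - β)) by ring, Real.rpow_add hwc, Real.rpow_one]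
        rw [← this]
        ring_nf

/-- The case `s = 1` on the ball that supports `k x ·`; the exponent `β` is positive and `wt`, `m`
are at most one, so the bound is uniform in `x`. -/
theorem exists_lintegral_le (hn : 1 ≤ n) (hk : FracKernel β k) (hβ0 : 0 < β) :
    ∃ C : ℝ, 0 < C ∧ ∀ x, ∫⁻ y, ENNReal.ofReal (k x y) ∂(gauss n) ≤ ENNReal.ofReal C := by
  obtain ⟨A, hA, hsupp⟩ := hk.supp
  obtain ⟨C, hC, h⟩ := hk.exists_lintegral_rpow_le hn hA zero_le_one (by linarith)
  refine ⟨C * (A ^ n) ^ β, by positivity, fun x => ?_⟩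
  have hm := m_pos x
  have hw := wt_pos x
  have hz : ∀ y ∉ Metric.ball x (A * m x), ENNReal.ofReal (k x y) = 0 := by
    intro y hy
    have : k x y = 0 := by
      by_contra h0
      exact hy (by rw [Metric.mem_ball, dist_comm]; exact (hsupp x y h0).1)
    simp [this]
  rw [← setLIntegral_eq_of_support_subset (s := Metric.ball x (A * m x))]
  · have h1 := h x (A * m x) (by positivity) le_rfl x (Metric.mem_ball_self (by positivity))
    simp only [ENNReal.rpow_one] at h1
    refine h1.trans (ENNReal.ofReal_le_ofReal ?_)
    have e : 1 - 1 * (1 - β) = β := by ring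
    rw [e]
    have : wt x * (A * m x) ^ n ≤ A ^ n := by
      rw [mul_pow]
      calc wt x * (A ^ n * m x ^ n) ≤ 1 * (A ^ n * 1) := by
            gcongr
            · exact wt_le_one x
            · exact pow_le_one₀ hm.le (m_le_one x)
        _ = A ^ n := by ring
    gcongr
  · intro y hy
    by_contra h0
    exact hy (hz y h0)

theorem rpow_add_le {u v q : ℝ} (hu : 0 ≤ u) (hv : 0 ≤ v) (hq : 0 ≤ q) :
    (u + v) ^ q ≤ 2 ^ q * (u ^ q + v ^ q) := by
  have h1 : (max u v) ^ q ≤ u ^ q + v ^ q := by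
    have := Real.rpow_nonneg hu q
    have := Real.rpow_nonneg hv q
    rcases max_cases u v with h | h <;> rw [h.1] <;> linarith
  calc (u + v) ^ q ≤ (2 * max u v) ^ q := by
        gcongr
        linarith [le_max_left u v, le_max_right u v]
    _ = 2 ^ q * (max u v) ^ q := Real.mul_rpow (by norm_num) (le_max_of_le_left hu)
    _ ≤ _ := by gcongr

/-- The exponent `1 / (1 - β)` turns the two terms of the oscillation bound into `(r / d) ^ q * d ^
(-n)`, whose integral off the ball is scale invariant, and `m c ^ (-n)`, integrated over a ball of
radius comparable to `m c`. The factor `(wt c)⁻¹` cancels the weight of the measure. -/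
theorem exists_lintegral_osc_le (hk : FracKernel β k) (hβ1 : β < 1) {A : ℝ} (hA : 0 < A) :
    ∃ C : ℝ, 0 < C ∧ ∀ (c : E n) (r : ℝ), 0 < r → r ≤ A * m c →
      ∀ x ∈ Metric.ball c r, ∀ x' ∈ Metric.ball c r,
      ∫⁻ y in (Metric.ball c (9 * r))ᶜ, ‖k x y - k x' y‖ₑ ^ (1 / (1 - β)) ∂(gauss n) ≤
        ENNReal.ofReal C := by
  set q := 1 / (1 - β) with hq
  have h1β : 0 < 1 - β := by linarith
  have hq0 : 0 < q := by positivity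
  have hqβ : (-(1 - β)) * q = -1 := by rw [hq]; field_simp
  obtain ⟨A₀, hA₀, hsupp⟩ := hk.supp
  obtain ⟨C₁, hC₁, h₁⟩ := hk.osc_left A hA
  obtain ⟨C₂, hC₂, h₂⟩ := exists_lintegral_compl_ball_le (n := n) hq0
  -- If `k z y ≠ 0` with `z` in the ball, then `dist y c` is less than `r + A₀ * m z`, and `m z ≤ (1
  -- + A) * m c`.
  set A₁ := A + A₀ * (1 + A) with hA₁
  have hA₁0 : 0 < A₁ := by positivity
  have hg := gaussConst_pos n
  have hw := wtConst_pos A₁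
  have hu := unitVol_pos (n := n)
  refine ⟨gaussConst n * wtConst A₁ * (C₁ ^ q * 2 ^ q) * (C₂ + A₁ ^ n * unitVol n),
    by positivity, fun c r hr hrA x hx x' hx' => ?_⟩
  have hwc := wt_pos c
  have hm := m_pos c
  have hfar : ∀ z ∈ Metric.ball c r, ∀ y ∉ Metric.ball c (A₁ * m c), k z y = 0 := by
    intro z hz y hy
    by_contra h0
    apply hy
    have hz' : dist z c < r := hz
    have h3 := (hsupp z y h0).1
    have h4 : m z ≤ (1 + A) * m c := m_le_of_dist' hA.le (by rw [dist_comm]; linarith)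
    have h5 := dist_triangle_left y c z
    have h6 : A₀ * m z ≤ A₀ * ((1 + A) * m c) := by gcongr
    rw [Metric.mem_ball, hA₁]
    nlinarith
  set S := (Metric.ball c (9 * r))ᶜ ∩ Metric.ball c (A₁ * m c) with hS
  have hSm : MeasurableSet S :=
    Metric.isOpen_ball.measurableSet.compl.inter Metric.isOpen_ball.measurableSet
  have hSc : S ⊆ Metric.closedBall c (A₁ * m c) :=
    Set.inter_subset_right.trans Metric.ball_subset_closedBall
  have hpt : ∀ y ∈ S, ‖k x y - k x' y‖ₑ ^ q ≤
      ENNReal.ofReal (C₁ ^ q * 2 ^ q * (wt c)⁻¹) *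
        (ENNReal.ofReal ((r / dist y c) ^ q * (dist y c ^ n)⁻¹) +
          ENNReal.ofReal ((m c ^ n)⁻¹)) := by
    intro y hy
    have hy9 : 9 * r ≤ dist y c := by simpa using hy.1
    have hd : 0 < dist y c := by linarith
    rw [← ENNReal.ofReal_add (by positivity) (by positivity),
      ← ENNReal.ofReal_mul (by positivity), Real.enorm_eq_ofReal_abs,
      ENNReal.ofReal_rpow_of_nonneg (abs_nonneg _) hq0.le]
    apply ENNReal.ofReal_le_ofReal
    refine (Real.rpow_le_rpow (abs_nonneg _) (h₁ c r hr hrA x x' y hx hx' hy9) hq0.le).trans ?_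
    rw [Real.mul_rpow hC₁.le (by positivity), Real.mul_rpow (by positivity) (by positivity),
      ← Real.rpow_mul hwc.le, hqβ, Real.rpow_neg_one]
    have h3 := rpow_add_le (u := r / dist y c * (dist y c ^ n) ^ (-(1 - β)))
      (v := (m c ^ n) ^ (-(1 - β))) (by positivity) (by positivity) hq0.le
    rw [Real.mul_rpow (by positivity) (by positivity), ← Real.rpow_mul (by positivity),
      ← Real.rpow_mul (by positivity), hqβ, Real.rpow_neg_one, Real.rpow_neg_one] at h3
    calc _ ≤ C₁ ^ q * ((wt c)⁻¹ * (2 ^ q *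
          ((r / dist y c) ^ q * (dist y c ^ n)⁻¹ + (m c ^ n)⁻¹))) := by gcongr
      _ = _ := by ring
  calc ∫⁻ y in (Metric.ball c (9 * r))ᶜ, ‖k x y - k x' y‖ₑ ^ q ∂(gauss n)
      ≤ ∫⁻ y in S, ‖k x y - k x' y‖ₑ ^ q ∂(gauss n) := by
        have h3 := setLIntegral_eq_of_support_subset (s := Metric.ball c (A₁ * m c))
          (μ := (gauss n).restrict (Metric.ball c (9 * r))ᶜ)
          (f := fun y => ‖k x y - k x' y‖ₑ ^ q) (by
            intro y hy
            by_contra h0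
            apply hy
            simp only
            rw [hfar x hx y h0, hfar x' hx' y h0]
            simp [hq0])
        rw [Measure.restrict_restrict Metric.isOpen_ball.measurableSet, Set.inter_comm] at h3
        exact h3.ge
    _ ≤ ENNReal.ofReal (gaussConst n * wtConst A₁ * wt c) *
        ∫⁻ y in S, ‖k x y - k x' y‖ₑ ^ q := lintegral_gauss_le hA₁0.le hSm hSc _
    _ ≤ ENNReal.ofReal (gaussConst n * wtConst A₁ * wt c) *
        (ENNReal.ofReal (C₁ ^ q * 2 ^ q * (wt c)⁻¹) *
          (ENNReal.ofReal C₂ + ENNReal.ofReal (A₁ ^ n * unitVol n))) := by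
        gcongr
        refine (setLIntegral_mono' hSm hpt).trans ?_
        rw [lintegral_const_mul' _ _ ENNReal.ofReal_ne_top,
          lintegral_add_right _ measurable_const]
        gcongr
        · refine (lintegral_mono_set ?_).trans (h₂ c r hr)
          exact Set.inter_subset_left.trans
            (Set.compl_subset_compl.mpr (Metric.ball_subset_ball (by linarith)))
        · rw [setLIntegral_const]
          refine (mul_le_mul_right (measure_mono (Set.inter_subset_right)) _).trans ?_
          rw [volume_ball_eq c (by positivity), ← ENNReal.ofReal_mul (by positivity)]
          apply ENNReal.ofReal_le_ofReal
          rw [mul_pow]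
          field_simp
          rfl
    _ = _ := by
        rw [← ENNReal.ofReal_add (by positivity) (by positivity),
          ← ENNReal.ofReal_mul (by positivity), ← ENNReal.ofReal_mul (by positivity)]
        congr 1
        field_simp

end FracKernel

/-! ### The operator on `L¹`, and its near and far parts on a ball -/

/-- The integral operator with kernel `k` with respect to the Gauss measure. -/
def kernelOp {F : Type*} [NormedAddCommGroup F] [NormedSpace ℝ F]
    (k : E n → E n → ℝ) (f : E n → F) (x : E n) : F :=
  ∫ y, k x y • f y ∂(gauss n)

/-- The normalised restriction of the Gauss measure to a ball. -/
def ballProb (c : E n) (r : ℝ) : Measure (E n) :=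
  ((gauss n).restrict (Metric.ball c r) Set.univ)⁻¹ • (gauss n).restrict (Metric.ball c r)

theorem isProbabilityMeasure_ballProb (c : E n) {r : ℝ} (hr : 0 < r) :
    IsProbabilityMeasure (ballProb c r) := by
  have : NeZero ((gauss n).restrict (Metric.ball c r)) :=
    ⟨fun h => (gauss_ball_pos c hr).ne' (Measure.restrict_eq_zero.mp h)⟩
  exact isProbabilityMeasureSMul

theorem ballProb_absolutelyContinuous (c : E n) (r : ℝ) :
    ballProb c r ≪ (gauss n).restrict (Metric.ball c r) :=
  Measure.smul_absolutelyContinuous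

theorem ballProb_absolutelyContinuous_gauss (c : E n) (r : ℝ) :
    ballProb c r ≪ gauss n :=
  (ballProb_absolutelyContinuous c r).trans Measure.absolutelyContinuous_restrict

theorem ae_ballProb_mem (c : E n) (r : ℝ) : ∀ᵐ x ∂(ballProb c r), x ∈ Metric.ball c r :=
  (ballProb_absolutelyContinuous c r).ae_le
    (ae_restrict_mem Metric.isOpen_ball.measurableSet)

theorem lintegral_ballProb (c : E n) (r : ℝ) (f : E n → ℝ≥0∞) :
    ∫⁻ x, f x ∂(ballProb c r) =
      (gauss n (Metric.ball c r))⁻¹ * ∫⁻ x in Metric.ball c r, f x ∂(gauss n) := by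
  rw [ballProb, lintegral_smul_measure, smul_eq_mul, Measure.restrict_apply_univ]

theorem integrable_ballProb {F : Type*} [NormedAddCommGroup F] {f : E n → F}
    (hf : Integrable f (gauss n)) (c : E n) {r : ℝ} (hr : 0 < r) :
    Integrable f (ballProb c r) := by
  refine (hf.restrict (s := Metric.ball c r)).smul_measure ?_
  rw [Measure.restrict_apply_univ]
  exact ENNReal.inv_ne_top.mpr (gauss_ball_pos c hr).ne'

theorem setLIntegral_le_rpow_mul {α : Type*} [MeasurableSpace α] {μ : Measure α} {β : ℝ}
    (hβ0 : 0 < β) (hβ1 : β < 1) {G : α → ℝ≥0∞} (hG : AEMeasurable G μ) (S : Set α) :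
    ∫⁻ y in S, G y ∂μ ≤ (∫⁻ y in S, G y ^ (1 / β) ∂μ) ^ β * μ S ^ (1 - β) := by
  have h := ENNReal.lintegral_mul_norm_pow_le (μ := μ.restrict S)
    (f := fun y => G y ^ (1 / β)) (g := fun _ => 1) (hG.restrict.pow_const _) aemeasurable_const
    hβ0.le (by linarith : 0 ≤ 1 - β) (by ring)
  simpa [← ENNReal.rpow_mul, hβ0.ne'] using h

namespace FracKernel

variable {β : ℝ} {k : E n → E n → ℝ}

theorem aemeasurable_mul (hk : FracKernel β k) {μ ν : Measure (E n)} [SFinite ν] {G : E n → ℝ≥0∞}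
    (hG : AEMeasurable G ν) :
    AEMeasurable (Function.uncurry fun x y => ENNReal.ofReal (k x y) * G y) (μ.prod ν) :=
  hk.measurable_ofReal.aemeasurable.mul
    (hG.comp_quasiMeasurePreserving Measure.quasiMeasurePreserving_snd)

theorem aestronglyMeasurable_smul (hk : FracKernel β k) {F : Type*} [NormedAddCommGroup F]
    [NormedSpace ℝ F] {μ ν : Measure (E n)} [SFinite ν] {f : E n → F}
    (hf : AEStronglyMeasurable f ν) :
    AEStronglyMeasurable (fun p : E n × E n => k p.1 p.2 • f p.2) (μ.prod ν) :=
  hk.measurable.aestronglyMeasurable.smul hf.comp_snd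

theorem enorm_smul_eq (hk : FracKernel β k) {F : Type*} [NormedAddCommGroup F]
    [NormedSpace ℝ F] (f : E n → F) (x y : E n) :
    ‖k x y • f y‖ₑ = ENNReal.ofReal (k x y) * ‖f y‖ₑ := by
  rw [enorm_smul, Real.enorm_eq_ofReal (hk.nonneg x y)]

/-- Tonelli, with the uniform bound applied to the integral of `k` in its first variable. -/
theorem exists_lintegral_lintegral_le (hn : 1 ≤ n) (hk : FracKernel β k) (hβ0 : 0 < β) :
    ∃ C : ℝ, 0 < C ∧ ∀ G : E n → ℝ≥0∞, AEMeasurable G (gauss n) →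
      ∫⁻ x, ∫⁻ y, ENNReal.ofReal (k x y) * G y ∂(gauss n) ∂(gauss n) ≤
        ENNReal.ofReal C * ∫⁻ y, G y ∂(gauss n) := by
  obtain ⟨C, hC, h⟩ := hk.swap.exists_lintegral_le hn hβ0
  refine ⟨C, hC, fun G hG => ?_⟩
  rw [lintegral_lintegral_swap (hk.aemeasurable_mul hG),
    ← lintegral_const_mul' _ _ ENNReal.ofReal_ne_top]
  refine lintegral_mono fun y => ?_
  rw [lintegral_mul_const _ (hk.swap.measurable_right y).ennreal_ofReal]
  exact mul_le_mul_left (h y) _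

theorem exists_kernelOp_integrable (hn : 1 ≤ n) (hk : FracKernel β k) (hβ0 : 0 < β)
    (F : Type*) [NormedAddCommGroup F] [NormedSpace ℝ F] :
    ∃ C : ℝ, 0 < C ∧ ∀ f : E n → F, Integrable f (gauss n) →
      (∀ᵐ x ∂(gauss n), Integrable (fun y => k x y • f y) (gauss n)) ∧
      Integrable (kernelOp k f) (gauss n) ∧
      eLpNorm (kernelOp k f) 1 (gauss n) ≤ ENNReal.ofReal C * eLpNorm f 1 (gauss n) := by
  obtain ⟨C, hC, h⟩ := hk.exists_lintegral_lintegral_le hn hβ0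
  refine ⟨C, hC, fun f hf => ?_⟩
  have h1 := h (fun y => ‖f y‖ₑ) hf.1.enorm
  simp_rw [← hk.enorm_smul_eq f] at h1
  have hm := hk.aestronglyMeasurable_smul (μ := gauss n) hf.1
  have hint : Integrable (fun p : E n × E n => k p.1 p.2 • f p.2) ((gauss n).prod (gauss n)) := by
    refine ⟨hm, ?_⟩
    rw [hasFiniteIntegral_iff_enorm, lintegral_prod _ hm.enorm]
    exact h1.trans_lt (ENNReal.mul_lt_top ENNReal.ofReal_lt_top hf.2)
  refine ⟨hint.prod_right_ae, hint.integral_prod_left, ?_⟩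
  rw [eLpNorm_one_eq_lintegral_enorm, eLpNorm_one_eq_lintegral_enorm]
  exact (lintegral_mono fun x => enorm_integral_le_lintegral_enorm _).trans h1

/-- Integrating in `x` first costs `Q ^ β`; Hölder for `G` on `9B` costs a multiple of `Q ^ (1 -
β)`. Together they give `Q`, a multiple of `P`, which the average over the ball divides out. -/
theorem exists_avg_near_le (hn : 1 ≤ n) (hk : FracKernel β k) (hβ0 : 0 < β) (hβ1 : β < 1)
    {A : ℝ} (hA : 0 < A) :
    ∃ C : ℝ, 0 < C ∧ ∀ (c : E n) (r : ℝ), 0 < r → r ≤ A * m c →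
      ∀ G : E n → ℝ≥0∞, AEMeasurable G (gauss n) →
      ∫⁻ x, ∫⁻ y in Metric.ball c (9 * r), ENNReal.ofReal (k x y) * G y ∂(gauss n) ∂(ballProb c r) ≤
        ENNReal.ofReal C * (∫⁻ y, G y ^ (1 / β) ∂(gauss n)) ^ β := by
  obtain ⟨C₁, hC₁, h₁⟩ := hk.swap.exists_lintegral_rpow_le (A := 9 * A) (s := 1) hn (by positivity)
    zero_le_one (by linarith)
  have hg := gaussConst_pos n
  have hw := wtConst_pos A
  have hw9 := wtConst_pos (9 * A)
  have hu := unitVol_pos (n := n)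
  set κ₁ := gaussConst n / wtConst A * unitVol n with hκ₁
  set κ₂ := gaussConst n * wtConst (9 * A) * unitVol n with hκ₂
  have hκ₁0 : 0 < κ₁ := by positivity
  have hκ₂0 : 0 < κ₂ := by positivity
  refine ⟨κ₁⁻¹ * C₁ * κ₂ ^ (1 - β) * 9 ^ n, by positivity, fun c r hr hrA G hG => ?_⟩
  have hwc := wt_pos c
  set P := wt c * r ^ n with hP
  have hP0 : 0 < P := by positivity
  set Q := wt c * (9 * r) ^ n with hQ
  have hQP : Q = 9 ^ n * P := by rw [hQ, hP, mul_pow]; ring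
  have hQ0 : 0 < Q := by positivity
  have hinner : ∀ y ∈ Metric.ball c (9 * r),
      ∫⁻ x in Metric.ball c r, ENNReal.ofReal (k x y) ∂(gauss n) ≤ ENNReal.ofReal (C₁ * Q ^ β) := by
    intro y hy
    have h2 := h₁ c (9 * r) (by positivity) (by linarith) y hy
    simp only [ENNReal.rpow_one, one_mul, sub_sub_cancel] at h2
    exact (lintegral_mono_set (Metric.ball_subset_ball (by linarith))).trans h2
  have hγ : (gauss n (Metric.ball c r))⁻¹ ≤ ENNReal.ofReal ((κ₁ * P)⁻¹) := by
    rw [ENNReal.ofReal_inv_of_pos (by positivity)]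
    exact ENNReal.inv_le_inv.mpr (le_gauss_ball hA.le hr hrA)
  have hγ9 : gauss n (Metric.ball c (9 * r)) ≤ ENNReal.ofReal (κ₂ * Q) :=
    gauss_ball_le (by positivity) (by positivity) (by linarith)
  rw [lintegral_ballProb, lintegral_lintegral_swap (hk.aemeasurable_mul hG.restrict)]
  calc _ ≤ ENNReal.ofReal ((κ₁ * P)⁻¹) * ∫⁻ y in Metric.ball c (9 * r),
        ENNReal.ofReal (C₁ * Q ^ β) * G y ∂(gauss n) := by
        refine mul_le_mul' hγ (setLIntegral_mono' Metric.isOpen_ball.measurableSet fun y hy => ?_)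
        rw [lintegral_mul_const _ (hk.swap.measurable_right y).ennreal_ofReal]
        exact mul_le_mul_left (hinner y hy) _
    _ ≤ ENNReal.ofReal ((κ₁ * P)⁻¹) * (ENNReal.ofReal (C₁ * Q ^ β) *
        ((∫⁻ y, G y ^ (1 / β) ∂(gauss n)) ^ β * ENNReal.ofReal (κ₂ * Q) ^ (1 - β))) := by
        rw [lintegral_const_mul' _ _ ENNReal.ofReal_ne_top]
        gcongr
        refine (setLIntegral_le_rpow_mul hβ0 hβ1 hG _).trans ?_
        gcongr
        exact Measure.restrict_le_self
    _ = ENNReal.ofReal ((κ₁ * P)⁻¹ * (C₁ * Q ^ β) * (κ₂ * Q) ^ (1 - β)) *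
        (∫⁻ y, G y ^ (1 / β) ∂(gauss n)) ^ β := by
        rw [ENNReal.ofReal_rpow_of_nonneg (by positivity) (by linarith),
          ENNReal.ofReal_mul (p := (κ₁ * P)⁻¹ * (C₁ * Q ^ β)) (by positivity),
          ENNReal.ofReal_mul (p := (κ₁ * P)⁻¹) (by positivity)]
        ring
    _ = _ := by
        congr 2
        rw [Real.mul_rpow hκ₂0.le hQ0.le]
        have : Q ^ β * Q ^ (1 - β) = 9 ^ n * P := by
          rw [← Real.rpow_add hQ0, add_sub_cancel, Real.rpow_one, hQP]
        calc _ = (κ₁ * P)⁻¹ * C₁ * κ₂ ^ (1 - β) * (Q ^ β * Q ^ (1 - β)) := by ring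
          _ = _ := by rw [this]; field_simp

theorem exists_far_le (hk : FracKernel β k) (hβ0 : 0 < β) (hβ1 : β < 1)
    {A : ℝ} (hA : 0 < A) :
    ∃ C : ℝ, 0 < C ∧ ∀ (c : E n) (r : ℝ), 0 < r → r ≤ A * m c →
      ∀ G : E n → ℝ≥0∞, AEMeasurable G (gauss n) →
      ∀ x ∈ Metric.ball c r, ∀ x' ∈ Metric.ball c r,
      ∫⁻ y in (Metric.ball c (9 * r))ᶜ, ‖k x y - k x' y‖ₑ * G y ∂(gauss n) ≤
        ENNReal.ofReal C * (∫⁻ y, G y ^ (1 / β) ∂(gauss n)) ^ β := by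
  obtain ⟨C, hC, h⟩ := hk.exists_lintegral_osc_le hβ1 hA
  refine ⟨C ^ (1 - β), by positivity, fun c r hr hrA G hG x hx x' hx' => ?_⟩
  have h1β : 0 < 1 - β := by linarith
  have hpq : (1 / (1 - β)).HolderConjugate (1 / β) := by
    rw [Real.holderConjugate_iff]
    refine ⟨?_, by simp⟩
    rw [lt_div_iff₀ h1β]; linarith
  have h2 := ENNReal.lintegral_mul_le_Lp_mul_Lq ((gauss n).restrict (Metric.ball c (9 * r))ᶜ) hpq
    (f := fun y => ‖k x y - k x' y‖ₑ) (g := G)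
    ((hk.measurable_right x).sub (hk.measurable_right x')).enorm.aemeasurable hG.restrict
  rw [one_div_one_div, one_div_one_div] at h2
  refine h2.trans ?_
  rw [← ENNReal.ofReal_rpow_of_pos hC]
  gcongr
  · exact h c r hr hrA x hx x' hx'
  · exact Measure.restrict_le_self

/-- A one-sided comparison: by positivity the integral at `x'` over the complement of `9B` is at
most the full integral, so no near term at `x'` appears. This is what makes a BLO bound possible. -/
theorem exists_lintegral_le_add (hk : FracKernel β k) (hβ0 : 0 < β) (hβ1 : β < 1)
    {A : ℝ} (hA : 0 < A) :
    ∃ C : ℝ, 0 < C ∧ ∀ (c : E n) (r : ℝ), 0 < r → r ≤ A * m c →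
      ∀ G : E n → ℝ≥0∞, AEMeasurable G (gauss n) →
      ∀ x ∈ Metric.ball c r, ∀ x' ∈ Metric.ball c r,
      ∫⁻ y, ENNReal.ofReal (k x y) * G y ∂(gauss n) ≤
        ∫⁻ y in Metric.ball c (9 * r), ENNReal.ofReal (k x y) * G y ∂(gauss n) +
        (∫⁻ y, ENNReal.ofReal (k x' y) * G y ∂(gauss n) +
          ENNReal.ofReal C * (∫⁻ y, G y ^ (1 / β) ∂(gauss n)) ^ β) := by
  obtain ⟨C, hC, h⟩ := hk.exists_far_le hβ0 hβ1 hA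
  refine ⟨C, hC, fun c r hr hrA G hG x hx x' hx' => ?_⟩
  have hB : MeasurableSet (Metric.ball c (9 * r)) := Metric.isOpen_ball.measurableSet
  rw [← lintegral_add_compl (fun y => ENNReal.ofReal (k x y) * G y) hB]
  gcongr
  have hpt : ∀ y, ENNReal.ofReal (k x y) * G y ≤
      ENNReal.ofReal (k x' y) * G y + ‖k x y - k x' y‖ₑ * G y := by
    intro y
    rw [← add_mul, Real.enorm_eq_ofReal_abs,
      ← ENNReal.ofReal_add (hk.nonneg _ _) (abs_nonneg _)]
    gcongr
    linarith [le_abs_self (k x y - k x' y)]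
  refine (lintegral_mono hpt).trans ?_
  have hm : AEMeasurable (fun y => ENNReal.ofReal (k x' y) * G y)
      ((gauss n).restrict (Metric.ball c (9 * r))ᶜ) :=
    (hk.measurable_right x').ennreal_ofReal.aemeasurable.mul hG.restrict
  rw [lintegral_add_left' hm]
  exact add_le_add (setLIntegral_le_lintegral _ _) (h c r hr hrA G hG x hx x' hx')

/-- Without a sign the near parts at both points remain, and both must be averaged. -/
theorem exists_enorm_sub_le (hk : FracKernel β k) (hβ0 : 0 < β) (hβ1 : β < 1)
    {A : ℝ} (hA : 0 < A) (F : Type*) [NormedAddCommGroup F] [NormedSpace ℝ F] :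
    ∃ C : ℝ, 0 < C ∧ ∀ (c : E n) (r : ℝ), 0 < r → r ≤ A * m c →
      ∀ f : E n → F, AEStronglyMeasurable f (gauss n) →
      ∀ x ∈ Metric.ball c r, ∀ x' ∈ Metric.ball c r,
      Integrable (fun y => k x y • f y) (gauss n) → Integrable (fun y => k x' y • f y) (gauss n) →
      ‖kernelOp k f x - kernelOp k f x'‖ₑ ≤
        ∫⁻ y in Metric.ball c (9 * r), ENNReal.ofReal (k x y) * ‖f y‖ₑ ∂(gauss n) +
        ∫⁻ y in Metric.ball c (9 * r), ENNReal.ofReal (k x' y) * ‖f y‖ₑ ∂(gauss n) +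
          ENNReal.ofReal C * (∫⁻ y, ‖f y‖ₑ ^ (1 / β) ∂(gauss n)) ^ β := by
  obtain ⟨C, hC, h⟩ := hk.exists_far_le hβ0 hβ1 hA
  refine ⟨C, hC, fun c r hr hrA f hf x hx x' hx' hi hi' => ?_⟩
  have hB : MeasurableSet (Metric.ball c (9 * r)) := Metric.isOpen_ball.measurableSet
  rw [kernelOp, kernelOp, ← integral_sub hi hi']
  refine (enorm_integral_le_lintegral_enorm _).trans ?_
  rw [← lintegral_add_compl _ hB]
  gcongr
  · rw [← lintegral_add_left' (hi.1.enorm.restrict.congr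
      (ae_of_all _ fun y => hk.enorm_smul_eq f x y))]
    refine lintegral_mono fun y => ?_
    rw [← hk.enorm_smul_eq, ← hk.enorm_smul_eq]
    exact enorm_sub_le
  · refine le_trans (lintegral_mono fun y => ?_) (h c r hr hrA _ hf.enorm x hx x' hx')
    rw [← sub_smul, enorm_smul]

end FracKernel

/-! ### From `L^{1/β}` to BLO and BMO -/

theorem eLpNorm_ofReal_one_div {α F : Type*} [MeasurableSpace α] {μ : Measure α}
    [NormedAddCommGroup F] {β : ℝ} (hβ0 : 0 < β) (f : α → F) :
    eLpNorm f (ENNReal.ofReal (1 / β)) μ = (∫⁻ y, ‖f y‖ₑ ^ (1 / β) ∂μ) ^ β := by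
  have h : 0 < 1 / β := by positivity
  rw [eLpNorm_eq_lintegral_rpow_enorm_toReal (by simpa using hβ0) ENNReal.ofReal_ne_top,
    ENNReal.toReal_ofReal h.le, one_div_one_div]

namespace FracKernel

variable {β : ℝ} {k : E n → E n → ℝ}

/-- The Gauss measure is finite, so `L^{1/β}` embeds in `L¹` and the `L¹` theory applies. -/
theorem exists_kernelOp_memLp (hn : 1 ≤ n) (hk : FracKernel β k) (hβ0 : 0 < β) (hβ1 : β < 1)
    (F : Type*) [NormedAddCommGroup F] [NormedSpace ℝ F] :
    ∃ C : ℝ≥0, ∀ f : E n → F, MemLp f (ENNReal.ofReal (1 / β)) (gauss n) →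
      (∀ᵐ x ∂(gauss n), Integrable (fun y => k x y • f y) (gauss n)) ∧
      Integrable (kernelOp k f) (gauss n) ∧
      eLpNorm (kernelOp k f) 1 (gauss n) ≤ C * eLpNorm f (ENNReal.ofReal (1 / β)) (gauss n) := by
  obtain ⟨C, hC, h⟩ := hk.exists_kernelOp_integrable hn hβ0 F
  set p := ENNReal.ofReal (1 / β) with hp
  have h1p : 1 ≤ p := by
    rw [hp, ENNReal.one_le_ofReal, le_div_iff₀ hβ0]; linarith
  set D := gauss n Set.univ ^ (1 / (1 : ℝ≥0∞).toReal - 1 / p.toReal) with hD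
  have hDt : D ≠ ∞ := by
    refine ENNReal.rpow_ne_top_of_nonneg ?_ (measure_ne_top _ _)
    rw [hp, ENNReal.toReal_ofReal (by positivity)]
    simp [hβ1.le]
  refine ⟨C.toNNReal * D.toNNReal, fun f hf => ?_⟩
  have hfi : Integrable f (gauss n) := hf.integrable h1p
  obtain ⟨h1, h2, h3⟩ := h f hfi
  refine ⟨h1, h2, h3.trans ?_⟩
  rw [ENNReal.coe_mul, ENNReal.coe_toNNReal hDt, mul_assoc, mul_comm D]
  gcongr
  · exact le_rfl
  · exact eLpNorm_le_eLpNorm_mul_rpow_measure_univ h1p hf.1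

/-- The one-sided comparison is averaged over its first point only, the second being fixed almost
everywhere in the ball. -/
theorem exists_average_le (hn : 1 ≤ n) (hk : FracKernel β k) (hβ0 : 0 < β) (hβ1 : β < 1)
    {A : ℝ} (hA : 0 < A) :
    ∃ C : ℝ, 0 < C ∧ ∀ (c : E n) (r : ℝ), 0 < r → r ≤ A * m c →
      ∀ f : E n → ℝ, MemLp f (ENNReal.ofReal (1 / β)) (gauss n) → 0 ≤ᵐ[gauss n] f →
      ∀ᵐ x ∂(gauss n).restrict (Metric.ball c r),
      ∫ y, kernelOp k f y ∂(ballProb c r) ≤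
        kernelOp k f x + C * (eLpNorm f (ENNReal.ofReal (1 / β)) (gauss n)).toReal := by
  obtain ⟨C₁, hC₁, h₁⟩ := hk.exists_lintegral_le_add hβ0 hβ1 hA
  obtain ⟨C₂, hC₂, h₂⟩ := hk.exists_avg_near_le hn hβ0 hβ1 hA
  obtain ⟨C₀, h₀⟩ := hk.exists_kernelOp_memLp hn hβ0 hβ1 ℝ
  refine ⟨C₂ + C₁, by positivity, fun c r hr hrA f hf hf0 => ?_⟩
  obtain ⟨hi, hT, -⟩ := h₀ f hf
  have hG : AEMeasurable (fun y => ‖f y‖ₑ) (gauss n) := hf.1.enorm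
  set N := eLpNorm f (ENNReal.ofReal (1 / β)) (gauss n) with hN
  have hNe : (∫⁻ y, ‖f y‖ₑ ^ (1 / β) ∂(gauss n)) ^ β = N := (eLpNorm_ofReal_one_div hβ0 f).symm
  have hNt : N ≠ ∞ := hf.2.ne
  have hpos : ∀ x, 0 ≤ᵐ[gauss n] fun y => k x y • f y := fun x => by
    filter_upwards [hf0] with y hy using mul_nonneg (hk.nonneg x y) hy
  have hT0 : ∀ x, 0 ≤ kernelOp k f x := fun x => integral_nonneg_of_ae (hpos x)
  have hrep : ∀ x, Integrable (fun y => k x y • f y) (gauss n) →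
      ∫⁻ y, ENNReal.ofReal (k x y) * ‖f y‖ₑ ∂(gauss n) = ENNReal.ofReal (kernelOp k f x) := by
    intro x hx
    rw [kernelOp, ofReal_integral_eq_lintegral_ofReal hx (hpos x)]
    refine lintegral_congr_ae ?_
    filter_upwards [hf0] with y hy
    rw [smul_eq_mul, ENNReal.ofReal_mul (hk.nonneg x y), Real.enorm_eq_ofReal hy]
  have := isProbabilityMeasure_ballProb c hr
  filter_upwards [ae_restrict_of_ae hi, ae_restrict_mem Metric.isOpen_ball.measurableSet]
    with x hx hxB
  have key : ENNReal.ofReal (∫ y, kernelOp k f y ∂(ballProb c r)) ≤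
      ENNReal.ofReal (kernelOp k f x + (C₂ + C₁) * N.toReal) := by
    rw [ofReal_integral_eq_lintegral_ofReal (integrable_ballProb hT c hr) (ae_of_all _ hT0)]
    calc ∫⁻ y, ENNReal.ofReal (kernelOp k f y) ∂(ballProb c r)
        ≤ ∫⁻ y, (∫⁻ z in Metric.ball c (9 * r), ENNReal.ofReal (k y z) * ‖f z‖ₑ ∂(gauss n)) +
          (ENNReal.ofReal (kernelOp k f x) + ENNReal.ofReal C₁ * N) ∂(ballProb c r) := by
          refine lintegral_mono_ae ?_
          filter_upwards [(ballProb_absolutelyContinuous_gauss c r).ae_le hi, ae_ballProb_mem c r]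
            with y hy hyB
          have h3 := h₁ c r hr hrA _ hG y hyB x hxB
          rwa [hNe, hrep y hy, hrep x hx] at h3
      _ ≤ ENNReal.ofReal C₂ * N + (ENNReal.ofReal (kernelOp k f x) + ENNReal.ofReal C₁ * N) := by
          rw [lintegral_add_right _ measurable_const, lintegral_const, measure_univ, mul_one]
          gcongr
          have h3 := h₂ c r hr hrA _ hG
          rwa [hNe] at h3
      _ = _ := by
          rw [ENNReal.ofReal_add (hT0 x) (by positivity), ENNReal.ofReal_mul (by positivity),
            ENNReal.ofReal_add hC₂.le hC₁.le, ENNReal.ofReal_toReal hNt]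
          ring
  exact (ENNReal.ofReal_le_ofReal_iff (add_nonneg (hT0 x) (by positivity))).mp key

theorem exists_bloNorm_le (hn : 1 ≤ n) (hk : FracKernel β k) (hβ0 : 0 < β) (hβ1 : β < 1)
    {a : ℝ} (ha : 0 < a) :
    ∃ C : ℝ≥0, ∀ f : E n → ℝ, MemLp f (ENNReal.ofReal (1 / β)) (gauss n) → 0 ≤ᵐ[gauss n] f →
      MemBLO a (kernelOp k f) ∧
      bloNorm a (kernelOp k f) ≤ C * eLpNorm f (ENNReal.ofReal (1 / β)) (gauss n) := by
  obtain ⟨C₀, h₀⟩ := hk.exists_kernelOp_memLp hn hβ0 hβ1 ℝ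
  obtain ⟨C₁, hC₁, h₁⟩ := hk.exists_average_le hn hβ0 hβ1 ha
  refine ⟨C₀ + C₁.toNNReal, fun f hf hf0 => ?_⟩
  obtain ⟨-, hT, hT1⟩ := h₀ f hf
  have hle : bloNorm a (kernelOp k f) ≤
      (C₀ + C₁.toNNReal : ℝ≥0) * eLpNorm f (ENNReal.ofReal (1 / β)) (gauss n) := by
    rw [bloNorm, ENNReal.coe_add, add_mul]
    refine add_le_add hT1 (iSup_le fun c => iSup_le fun r => iSup_le fun hr => ?_)
    have h2 := h₁ c r hr.1 hr.2 f hf hf0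
    -- The average over the ball unfolds to the integral against `ballProb`.
    change (((∫ y, kernelOp k f y ∂(ballProb c r) : ℝ) : EReal) - _).toENNReal ≤ _
    set N := eLpNorm f (ENNReal.ofReal (1 / β)) (gauss n)
    set I := ∫ y, kernelOp k f y ∂(ballProb c r)
    have h3 : ((I - C₁ * N.toReal : ℝ) : EReal) ≤
        essInf (fun x => ((kernelOp k f x : ℝ) : EReal)) ((gauss n).restrict (Metric.ball c r)) := by
      refine le_essInf_of_ae_le _ ?_
      filter_upwards [h2] with x hx
      exact EReal.coe_le_coe_iff.mpr (by linarith)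
    have h4 : (I : EReal) -
        essInf (fun x => ((kernelOp k f x : ℝ) : EReal)) ((gauss n).restrict (Metric.ball c r)) ≤
        ((C₁ * N.toReal : ℝ) : EReal) := by
      refine (EReal.sub_le_sub le_rfl h3).trans_eq ?_
      rw [← EReal.coe_sub]
      congr 1
      ring
    refine (EReal.toENNReal_le_toENNReal h4).trans_eq ?_
    rw [EReal.real_coe_toENNReal, ENNReal.ofReal_mul hC₁.le, ENNReal.ofReal_toReal hf.2.ne]
    rfl
  exact ⟨⟨hT.locallyIntegrable, hle.trans_lt (ENNReal.mul_lt_top ENNReal.coe_lt_top hf.2)⟩, hle⟩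

theorem exists_bmoNorm_le (hn : 1 ≤ n) (hk : FracKernel β k) (hβ0 : 0 < β) (hβ1 : β < 1) :
    ∃ C : ℝ≥0, ∀ f : E n → ℂ, MemLp f (ENNReal.ofReal (1 / β)) (gauss n) →
      MemBMO (kernelOp k f) ∧
      bmoNorm (kernelOp k f) ≤ C * eLpNorm f (ENNReal.ofReal (1 / β)) (gauss n) := by
  obtain ⟨C₀, h₀⟩ := hk.exists_kernelOp_memLp hn hβ0 hβ1 ℂ
  obtain ⟨C₁, hC₁, h₁⟩ := hk.exists_enorm_sub_le hβ0 hβ1 one_pos ℂ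
  obtain ⟨C₂, hC₂, h₂⟩ := hk.exists_avg_near_le hn hβ0 hβ1 one_pos
  refine ⟨C₀ + (C₂.toNNReal + C₂.toNNReal + C₁.toNNReal), fun f hf => ?_⟩
  obtain ⟨hi, hT, hT1⟩ := h₀ f hf
  set N := eLpNorm f (ENNReal.ofReal (1 / β)) (gauss n) with hN
  have hNe : (∫⁻ y, ‖f y‖ₑ ^ (1 / β) ∂(gauss n)) ^ β = N := (eLpNorm_ofReal_one_div hβ0 f).symm
  have hle : bmoNorm (kernelOp k f) ≤
      (C₀ + (C₂.toNNReal + C₂.toNNReal + C₁.toNNReal) : ℝ≥0) * N := by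
    rw [bmoNorm, ENNReal.coe_add, add_mul]
    refine add_le_add hT1 (iSup_le fun c => iSup_le fun r => iSup_le fun hr => ?_)
    change ∫⁻ x, ‖kernelOp k f x - ∫ y, kernelOp k f y ∂(ballProb c r)‖ₑ ∂(ballProb c r) ≤ _
    have := isProbabilityMeasure_ballProb c hr.1
    set M : E n → ℝ≥0∞ := fun x =>
      ∫⁻ y in Metric.ball c (9 * r), ENNReal.ofReal (k x y) * ‖f y‖ₑ ∂(gauss n) with hM
    have hMm : AEMeasurable M (ballProb c r) :=
      (hk.aemeasurable_mul (μ := ballProb c r) hf.1.enorm.restrict).lintegral_prod_right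
    have hMle : ∫⁻ x, M x ∂(ballProb c r) ≤ ENNReal.ofReal C₂ * N := by
      have h3 := h₂ c r hr.1 hr.2 _ hf.1.enorm
      rwa [hNe] at h3
    have hib : ∀ᵐ x ∂(ballProb c r), Integrable (fun y => k x y • f y) (gauss n) :=
      (ballProb_absolutelyContinuous_gauss c r).ae_le hi
    have hgood : ∀ᵐ x ∂(ballProb c r), Integrable (fun y => k x y • f y) (gauss n) ∧
        x ∈ Metric.ball c r :=
      hib.and (ae_ballProb_mem c r)
    have hTb := integrable_ballProb hT c hr.1
    -- Averaging in the second point turns its near part into a constant; the near part at `x` is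
    -- averaged afterwards.
    have hpt : ∀ᵐ x ∂(ballProb c r), ‖kernelOp k f x - ∫ y, kernelOp k f y ∂(ballProb c r)‖ₑ ≤
        M x + (ENNReal.ofReal C₂ * N + ENNReal.ofReal C₁ * N) := by
      filter_upwards [hgood] with x hx
      have e : kernelOp k f x - ∫ y, kernelOp k f y ∂(ballProb c r) =
          ∫ y, (kernelOp k f x - kernelOp k f y) ∂(ballProb c r) := by
        rw [integral_sub (integrable_const _) hTb]; simp
      rw [e]
      calc _ ≤ ∫⁻ y, ‖kernelOp k f x - kernelOp k f y‖ₑ ∂(ballProb c r) :=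
            enorm_integral_le_lintegral_enorm _
        _ ≤ ∫⁻ y, (M x + (M y + ENNReal.ofReal C₁ * N)) ∂(ballProb c r) := by
            refine lintegral_mono_ae ?_
            filter_upwards [hgood] with y hy
            have h3 := h₁ c r hr.1 hr.2 f hf.1 x hx.2 y hy.2 hx.1 hy.1
            rwa [hNe, add_assoc] at h3
        _ ≤ _ := by
            rw [lintegral_add_left measurable_const, lintegral_add_right _ measurable_const]
            simp only [lintegral_const, measure_univ, mul_one]
            gcongr
    refine (lintegral_mono_ae hpt).trans ?_
    rw [lintegral_add_right _ measurable_const, lintegral_const, measure_univ, mul_one]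
    refine (add_le_add_left hMle _).trans_eq ?_
    push_cast
    change _ = (ENNReal.ofReal C₂ + ENNReal.ofReal C₂ + ENNReal.ofReal C₁) * N
    ring
  exact ⟨⟨hT, hle.trans_lt (ENNReal.mul_lt_top ENNReal.coe_lt_top hf.2)⟩, hle⟩

end FracKernel

/-! ### Atoms and the Hardy space -/

/-- Jensen's inequality for the measure with density `G`, in the form of Hölder applied to `D * G =
(D ^ q * G) ^ (1 - β) * G ^ β` with `q = 1 / (1 - β)`. -/
theorem lintegral_mul_rpow_le {α : Type*} [MeasurableSpace α] {μ : Measure α} {β : ℝ}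
    (hβ0 : 0 < β) (hβ1 : β < 1) {D G : α → ℝ≥0∞} (hD : AEMeasurable D μ) (hG : AEMeasurable G μ) :
    (∫⁻ y, D y * G y ∂μ) ^ (1 / (1 - β)) ≤
      (∫⁻ y, D y ^ (1 / (1 - β)) * G y ∂μ) * (∫⁻ y, G y ∂μ) ^ (β / (1 - β)) := by
  have h1β : 0 < 1 - β := by linarith
  have h := ENNReal.lintegral_mul_norm_pow_le (μ := μ)
    (f := fun y => D y ^ (1 / (1 - β)) * G y) (g := G) ((hD.pow_const _).mul hG) hG
    h1β.le hβ0.le (by ring)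
  have e : ∀ y, (D y ^ (1 / (1 - β)) * G y) ^ (1 - β) * G y ^ β = D y * G y := by
    intro y
    rw [ENNReal.mul_rpow_of_nonneg _ _ h1β.le, ← ENNReal.rpow_mul, one_div_mul_cancel h1β.ne',
      ENNReal.rpow_one, mul_assoc, ← ENNReal.rpow_add_of_nonneg _ _ h1β.le hβ0.le,
      sub_add_cancel, ENNReal.rpow_one]
  simp_rw [e] at h
  refine (ENNReal.rpow_le_rpow h (by positivity : 0 ≤ 1 / (1 - β))).trans_eq ?_
  rw [ENNReal.mul_rpow_of_nonneg _ _ (by positivity), ← ENNReal.rpow_mul, ← ENNReal.rpow_mul,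
    mul_one_div_cancel h1β.ne', ENNReal.rpow_one, mul_one_div]

/-- The part of the definition of `(1, r)` atoms that concerns a given ball. -/
structure IsBallAtom (r : ℝ) (b : E n → ℂ) (c : E n) (ρ : ℝ) : Prop where
  integrable : Integrable b (gauss n)
  admissible : Admissible 1 c ρ
  support : ∀ᵐ x ∂(gauss n), x ∉ Metric.ball c ρ → b x = 0
  size : eLpNorm b (ENNReal.ofReal r) (gauss n) ≤ gauss n (Metric.ball c ρ) ^ (1 / r - 1)
  cancel : ∫ x in Metric.ball c ρ, b x ∂(gauss n) = 0

namespace IsBallAtom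

variable {r : ℝ} {b : E n → ℂ} {c : E n} {ρ : ℝ}

theorem lintegral_rpow_le (hb : IsBallAtom r b c ρ) (hr : 1 < r) :
    (∫⁻ y, ‖b y‖ₑ ^ r ∂(gauss n)) ^ (1 / r) ≤ gauss n (Metric.ball c ρ) ^ (1 / r - 1) := by
  have h := eLpNorm_ofReal_one_div (μ := gauss n) (by positivity : 0 < 1 / r) b
  rw [one_div_one_div] at h
  rw [← h]
  exact hb.size

theorem lintegral_le_one (hb : IsBallAtom r b c ρ) (hr : 1 < r) :
    ∫⁻ y, ‖b y‖ₑ ∂(gauss n) ≤ 1 := by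
  have hr1 : 1 / r < 1 := by rw [div_lt_one (by linarith)]; exact hr
  have hpos := gauss_ball_pos c hb.admissible.1
  have e : ∫⁻ y, ‖b y‖ₑ ∂(gauss n) = ∫⁻ y in Metric.ball c ρ, ‖b y‖ₑ ∂(gauss n) := by
    rw [← lintegral_indicator Metric.isOpen_ball.measurableSet]
    refine lintegral_congr_ae ?_
    filter_upwards [hb.support] with y hy
    by_cases hyB : y ∈ Metric.ball c ρ
    · rw [Set.indicator_of_mem hyB]
    · rw [Set.indicator_of_notMem hyB, hy hyB, enorm_zero]
  rw [e]
  refine (setLIntegral_le_rpow_mul (by positivity) hr1 hb.integrable.1.enorm _).trans ?_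
  rw [one_div_one_div]
  calc _ ≤ gauss n (Metric.ball c ρ) ^ (1 / r - 1) * gauss n (Metric.ball c ρ) ^ (1 - 1 / r) := by
        gcongr
        refine le_trans ?_ (hb.lintegral_rpow_le hr)
        gcongr
        exact Measure.restrict_le_self
    _ = 1 := by
        rw [← ENNReal.rpow_add _ _ hpos.ne' (measure_ne_top _ _)]
        simp

end IsBallAtom

namespace FracKernel

variable {β : ℝ} {k : E n → E n → ℝ}

/-- At the exponent `1 / (1 - β)` the power of the kernel just fails to be integrable. Hence `k` is
split as `(k ^ s) ^ (1 - β) * (k ^ (δ / 2)) ^ β` with `s` slightly smaller: the first factor is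
integrated in `x` by Tonelli, and the second is paired with `b` through Hölder at exponent `r`. The
powers `Q ^ t` and `Q ^ (-t)` then cancel. -/
theorem exists_atom_near_le (hn : 1 ≤ n) (hk : FracKernel β k) (hβ0 : 0 < β) (hβ1 : β < 1)
    {r : ℝ} (hr : 1 < r) :
    ∃ C : ℝ, 0 < C ∧ ∀ (b : E n → ℂ) (c : E n) (ρ : ℝ), IsBallAtom r b c ρ →
      ∫⁻ x in Metric.ball c (9 * ρ), (∫⁻ y in Metric.ball c ρ,
        ENNReal.ofReal (k x y) * ‖b y‖ₑ ∂(gauss n)) ^ (1 / (1 - β)) ∂(gauss n) ≤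
        ENNReal.ofReal C := by
  have h1β : 0 < 1 - β := by linarith
  set δ := 1 - 1 / r with hδ
  have hr1 : 1 / r < 1 := by rw [div_lt_one (by linarith)]; exact hr
  have hr0 : 0 < 1 / r := by positivity
  have hδ0 : 0 < δ := by linarith
  have hδ1 : δ < 1 := by linarith
  -- `t` is the power of `k` carried by the second factor, and `s` below is fixed by `s * (1 - β) +
  -- t = 1`.
  set t := β * δ / 2 with ht
  have ht0 : 0 < t := by positivity
  have ht1 : t < 1 := by nlinarith
  have hu0 : 0 < 1 - t := by linarith
  set s := (1 - t) / (1 - β) with hs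
  have hs0 : 0 < s := by positivity
  have hsβ : s * (1 - β) = 1 - t := by rw [hs]; field_simp
  obtain ⟨C₁, hC₁, h₁⟩ := hk.exists_lintegral_rpow_le (A := 9) (s := 1 / 2) hn (by norm_num)
    (by norm_num) (by linarith)
  obtain ⟨C₂, hC₂, h₂⟩ := hk.swap.exists_lintegral_rpow_le (A := 9) (s := s) hn (by norm_num)
    hs0.le (by rw [hsβ]; linarith)
  have hg := gaussConst_pos n
  have hw := wtConst_pos 1
  have hu := unitVol_pos (n := n)
  set κ₁ := gaussConst n / wtConst 1 * unitVol n with hκ₁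
  have hκ₁0 : 0 < κ₁ := by positivity
  refine ⟨(C₁ ^ δ * (κ₁ * (9 ^ n)⁻¹) ^ (-δ)) ^ (β / (1 - β)) * C₂, by positivity,
    fun b c ρ hb => ?_⟩
  have hρ := hb.admissible.1
  have hρ1 := hb.admissible.2
  have hwc := wt_pos c
  set G : E n → ℝ≥0∞ := fun y => ‖b y‖ₑ with hGdef
  have hG : AEMeasurable G (gauss n) := hb.integrable.1.enorm
  set Q := wt c * (9 * ρ) ^ n with hQ
  have hQ0 : 0 < Q := by positivity
  have hkm : ∀ x, Measurable fun y => ENNReal.ofReal (k x y) :=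
    fun x => (hk.measurable_right x).ennreal_ofReal
  have hsub : Metric.ball c ρ ⊆ Metric.ball c (9 * ρ) := Metric.ball_subset_ball (by linarith)
  have hγ : gauss n (Metric.ball c ρ) ^ (1 / r - 1) ≤
      ENNReal.ofReal ((κ₁ * (9 ^ n)⁻¹) ^ (-δ) * Q ^ (-δ)) := by
    have e : κ₁ * (9 ^ n)⁻¹ * Q = κ₁ * (wt c * ρ ^ n) := by
      rw [hQ, mul_pow]; field_simp
    rw [← Real.mul_rpow (by positivity) (by positivity), e, ← ENNReal.ofReal_rpow_of_pos
      (by positivity), show 1 / r - 1 = -δ by rw [hδ]; ring, ENNReal.rpow_neg, ENNReal.rpow_neg]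
    gcongr
    exact le_gauss_ball zero_le_one hρ hρ1
  have hsecond : ∀ x ∈ Metric.ball c (9 * ρ),
      ∫⁻ y in Metric.ball c ρ, ENNReal.ofReal (k x y) ^ (δ / 2) * G y ∂(gauss n) ≤
        ENNReal.ofReal (C₁ ^ δ * (κ₁ * (9 ^ n)⁻¹) ^ (-δ) * Q ^ (-(δ * (1 - β) / 2))) := by
    intro x hx
    have h3 := ENNReal.lintegral_mul_norm_pow_le (μ := (gauss n).restrict (Metric.ball c ρ))
      (f := fun y => ENNReal.ofReal (k x y) ^ (1 / 2 : ℝ)) (g := fun y => G y ^ r)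
      ((hkm x).pow_const _).aemeasurable (hG.restrict.pow_const _) hδ0.le hr0.le
      (by rw [hδ]; ring)
    have e : ∀ y, (ENNReal.ofReal (k x y) ^ (1 / 2 : ℝ)) ^ δ * (G y ^ r) ^ (1 / r) =
        ENNReal.ofReal (k x y) ^ (δ / 2) * G y := by
      intro y
      rw [← ENNReal.rpow_mul, ← ENNReal.rpow_mul, mul_one_div_cancel (by linarith),
        ENNReal.rpow_one]
      ring_nf
    simp_rw [e] at h3
    refine h3.trans ?_
    have h4 := (lintegral_mono_set hsub).trans (h₁ c (9 * ρ) (by positivity) (by linarith) x hx)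
    have h5 : (∫⁻ y in Metric.ball c ρ, G y ^ r ∂(gauss n)) ^ (1 / r) ≤
        ENNReal.ofReal ((κ₁ * (9 ^ n)⁻¹) ^ (-δ) * Q ^ (-δ)) :=
      le_trans (ENNReal.rpow_le_rpow (setLIntegral_le_lintegral _ _) hr0.le)
        ((hb.lintegral_rpow_le hr).trans hγ)
    refine (mul_le_mul' (ENNReal.rpow_le_rpow h4 hδ0.le) h5).trans_eq ?_
    rw [ENNReal.ofReal_rpow_of_pos (by positivity), ← ENNReal.ofReal_mul (by positivity),
      Real.mul_rpow hC₁.le (by positivity), ← Real.rpow_mul hQ0.le]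
    have e2 : Q ^ ((1 - 1 / 2 * (1 - β)) * δ) * Q ^ (-δ) = Q ^ (-(δ * (1 - β) / 2)) := by
      rw [← Real.rpow_add hQ0]; ring_nf
    rw [← e2]
    ring_nf
  have hpt : ∀ x ∈ Metric.ball c (9 * ρ), (∫⁻ y in Metric.ball c ρ,
      ENNReal.ofReal (k x y) * G y ∂(gauss n)) ^ (1 / (1 - β)) ≤
      ENNReal.ofReal ((C₁ ^ δ * (κ₁ * (9 ^ n)⁻¹) ^ (-δ)) ^ (β / (1 - β)) * Q ^ (-t)) *
      ∫⁻ y in Metric.ball c ρ, ENNReal.ofReal (k x y) ^ s * G y ∂(gauss n) := by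
    intro x hx
    have h3 := ENNReal.lintegral_mul_norm_pow_le (μ := (gauss n).restrict (Metric.ball c ρ))
      (f := fun y => ENNReal.ofReal (k x y) ^ s * G y)
      (g := fun y => ENNReal.ofReal (k x y) ^ (δ / 2) * G y)
      (((hkm x).pow_const _).aemeasurable.mul hG.restrict)
      (((hkm x).pow_const _).aemeasurable.mul hG.restrict) h1β.le hβ0.le (by ring)
    have e : ∀ y, (ENNReal.ofReal (k x y) ^ s * G y) ^ (1 - β) *
        (ENNReal.ofReal (k x y) ^ (δ / 2) * G y) ^ β = ENNReal.ofReal (k x y) * G y := by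
      intro y
      rw [ENNReal.mul_rpow_of_nonneg _ _ h1β.le, ENNReal.mul_rpow_of_nonneg _ _ hβ0.le,
        mul_mul_mul_comm, ← ENNReal.rpow_mul, ← ENNReal.rpow_mul, hsβ,
        show δ / 2 * β = t by rw [ht]; ring, ← ENNReal.rpow_add_of_nonneg _ _ hu0.le ht0.le,
        ← ENNReal.rpow_add_of_nonneg _ _ h1β.le hβ0.le, sub_add_cancel, sub_add_cancel,
        ENNReal.rpow_one, ENNReal.rpow_one]
    simp_rw [e] at h3
    refine (ENNReal.rpow_le_rpow h3 (by positivity : 0 ≤ 1 / (1 - β))).trans ?_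
    rw [ENNReal.mul_rpow_of_nonneg _ _ (by positivity), ← ENNReal.rpow_mul, ← ENNReal.rpow_mul,
      mul_one_div_cancel h1β.ne', ENNReal.rpow_one, mul_one_div, mul_comm]
    gcongr
    refine (ENNReal.rpow_le_rpow (hsecond x hx) (by positivity)).trans_eq ?_
    rw [ENNReal.ofReal_rpow_of_pos (by positivity), Real.mul_rpow (by positivity) (by positivity),
      ← Real.rpow_mul hQ0.le]
    congr 3
    rw [ht]; field_simp
  have hinner : ∀ y ∈ Metric.ball c ρ,
      ∫⁻ x in Metric.ball c (9 * ρ), ENNReal.ofReal (k x y) ^ s ∂(gauss n) ≤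
        ENNReal.ofReal (C₂ * Q ^ t) := by
    intro y hy
    have h3 := h₂ c (9 * ρ) (by positivity) (by linarith) y (hsub hy)
    rwa [hsβ, sub_sub_cancel] at h3
  refine (setLIntegral_mono' Metric.isOpen_ball.measurableSet hpt).trans ?_
  have hm2 : AEMeasurable (Function.uncurry fun x y => ENNReal.ofReal (k x y) ^ s * G y)
      (((gauss n).restrict (Metric.ball c (9 * ρ))).prod
        ((gauss n).restrict (Metric.ball c ρ))) :=
    (hk.measurable_ofReal.pow_const _).aemeasurable.mul
      (hG.restrict.comp_quasiMeasurePreserving Measure.quasiMeasurePreserving_snd)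
  rw [lintegral_const_mul' _ _ ENNReal.ofReal_ne_top, lintegral_lintegral_swap hm2]
  calc _ ≤ ENNReal.ofReal ((C₁ ^ δ * (κ₁ * (9 ^ n)⁻¹) ^ (-δ)) ^ (β / (1 - β)) * Q ^ (-t)) *
        ∫⁻ y in Metric.ball c ρ, ENNReal.ofReal (C₂ * Q ^ t) * G y ∂(gauss n) := by
        gcongr 1
        refine setLIntegral_mono' Metric.isOpen_ball.measurableSet fun y hy => ?_
        rw [lintegral_mul_const _
          ((hk.swap.measurable_right y).ennreal_ofReal.pow_const _)]
        exact mul_le_mul_left (hinner y hy) _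
    _ ≤ ENNReal.ofReal ((C₁ ^ δ * (κ₁ * (9 ^ n)⁻¹) ^ (-δ)) ^ (β / (1 - β)) * Q ^ (-t)) *
        (ENNReal.ofReal (C₂ * Q ^ t) * 1) := by
        rw [lintegral_const_mul' _ _ ENNReal.ofReal_ne_top]
        gcongr
        exact (setLIntegral_le_lintegral _ _).trans (hb.lintegral_le_one hr)
    _ = _ := by
        rw [mul_one, ← ENNReal.ofReal_mul (by positivity)]
        congr 1
        have : Q ^ (-t) * Q ^ t = 1 := by
          rw [← Real.rpow_add hQ0, neg_add_cancel, Real.rpow_zero]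
        calc _ = (C₁ ^ δ * (κ₁ * (9 ^ n)⁻¹) ^ (-δ)) ^ (β / (1 - β)) * C₂ * (Q ^ (-t) * Q ^ t) := by
              ring
          _ = _ := by rw [this, mul_one]

/-- Jensen moves the power onto the kernel difference, as `b` has `L¹` norm at most one; Tonelli
then leaves the uniform oscillation bound for the transposed kernel. -/
theorem exists_atom_far_le (hk : FracKernel β k) (hβ0 : 0 < β) (hβ1 : β < 1)
    {r : ℝ} (hr : 1 < r) :
    ∃ C : ℝ, 0 < C ∧ ∀ (b : E n → ℂ) (c : E n) (ρ : ℝ), IsBallAtom r b c ρ →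
      ∫⁻ x in (Metric.ball c (9 * ρ))ᶜ, (∫⁻ y in Metric.ball c ρ,
        ‖k x y - k x c‖ₑ * ‖b y‖ₑ ∂(gauss n)) ^ (1 / (1 - β)) ∂(gauss n) ≤
        ENNReal.ofReal C := by
  have h1β : 0 < 1 - β := by linarith
  obtain ⟨C, hC, h⟩ := hk.swap.exists_lintegral_osc_le hβ1 one_pos
  refine ⟨C, hC, fun b c ρ hb => ?_⟩
  have hρ := hb.admissible.1
  have hG : AEMeasurable (fun y => ‖b y‖ₑ) (gauss n) := hb.integrable.1.enorm
  have hdm : Measurable (Function.uncurry fun x y => ‖k x y - k x c‖ₑ) :=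
    (hk.measurable.sub ((hk.swap.measurable_right c).comp measurable_fst)).enorm
  have hpt : ∀ x, (∫⁻ y in Metric.ball c ρ, ‖k x y - k x c‖ₑ * ‖b y‖ₑ ∂(gauss n)) ^ (1 / (1 - β)) ≤
      ∫⁻ y in Metric.ball c ρ, ‖k x y - k x c‖ₑ ^ (1 / (1 - β)) * ‖b y‖ₑ ∂(gauss n) := by
    intro x
    refine (lintegral_mul_rpow_le hβ0 hβ1
      (hdm.comp measurable_prodMk_left).aemeasurable hG.restrict).trans ?_
    refine mul_le_of_le_one_right' (ENNReal.rpow_le_one ?_ (by positivity))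
    exact (setLIntegral_le_lintegral _ _).trans (hb.lintegral_le_one hr)
  refine (lintegral_mono hpt).trans ?_
  have hm2 : AEMeasurable (Function.uncurry fun x y => ‖k x y - k x c‖ₑ ^ (1 / (1 - β)) * ‖b y‖ₑ)
      (((gauss n).restrict (Metric.ball c (9 * ρ))ᶜ).prod
        ((gauss n).restrict (Metric.ball c ρ))) :=
    (hdm.pow_const _).aemeasurable.mul
      (hG.restrict.comp_quasiMeasurePreserving Measure.quasiMeasurePreserving_snd)
  rw [lintegral_lintegral_swap hm2]
  calc _ ≤ ∫⁻ y in Metric.ball c ρ, ENNReal.ofReal C * ‖b y‖ₑ ∂(gauss n) := by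
        refine setLIntegral_mono' Metric.isOpen_ball.measurableSet fun y hy => ?_
        have hdy : Measurable fun x => ‖k x y - k x c‖ₑ ^ (1 / (1 - β)) :=
          (hdm.comp measurable_prodMk_right).pow_const _
        rw [lintegral_mul_const _ hdy]
        exact mul_le_mul_left
          (h c ρ hρ hb.admissible.2 y hy c (Metric.mem_ball_self hρ)) _
    _ ≤ ENNReal.ofReal C * 1 := by
        rw [lintegral_const_mul' _ _ ENNReal.ofReal_ne_top]
        gcongr
        exact (setLIntegral_le_lintegral _ _).trans (hb.lintegral_le_one hr)
    _ = _ := mul_one _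

theorem exists_ballAtom_le (hn : 1 ≤ n) (hk : FracKernel β k) (hβ0 : 0 < β) (hβ1 : β < 1)
    {r : ℝ} (hr : 1 < r) :
    ∃ C : ℝ, 0 < C ∧ ∀ (b : E n → ℂ) (c : E n) (ρ : ℝ), IsBallAtom r b c ρ →
      eLpNorm (kernelOp k b) (ENNReal.ofReal (1 / (1 - β))) (gauss n) ≤ ENNReal.ofReal C := by
  have h1β : 0 < 1 - β := by linarith
  have hq0 : 0 < 1 / (1 - β) := by positivity
  obtain ⟨C₁, hC₁, h₁⟩ := hk.exists_atom_near_le hn hβ0 hβ1 hr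
  obtain ⟨C₂, hC₂, h₂⟩ := hk.exists_atom_far_le hβ0 hβ1 hr
  obtain ⟨_, _, h₀⟩ := hk.exists_kernelOp_integrable hn hβ0 ℂ
  refine ⟨(C₁ + C₂) ^ (1 - β), by positivity, fun b c ρ hb => ?_⟩
  obtain ⟨hi, -, -⟩ := h₀ b hb.integrable
  have hrep : ∀ x, kernelOp k b x = ∫ y in Metric.ball c ρ, k x y • b y ∂(gauss n) := by
    intro x
    refine (setIntegral_eq_integral_of_ae_compl_eq_zero ?_).symm
    filter_upwards [hb.support] with y hy hyB
    rw [hy hyB, smul_zero]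
  rw [eLpNorm_ofReal_one_div h1β, ← ENNReal.ofReal_rpow_of_pos (by positivity)]
  refine ENNReal.rpow_le_rpow ?_ h1β.le
  rw [← lintegral_add_compl _ (Metric.isOpen_ball (x := c) (ε := 9 * ρ)).measurableSet,
    ENNReal.ofReal_add hC₁.le hC₂.le]
  refine add_le_add (le_trans (lintegral_mono fun x => ?_) (h₁ b c ρ hb))
    (le_trans (lintegral_mono_ae ?_) (h₂ b c ρ hb))
  · refine ENNReal.rpow_le_rpow ?_ hq0.le
    rw [hrep]
    refine (enorm_integral_le_lintegral_enorm _).trans_eq ?_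
    simp_rw [hk.enorm_smul_eq]
  · filter_upwards [ae_restrict_of_ae hi] with x hx
    refine ENNReal.rpow_le_rpow ?_ hq0.le
    -- Since `b` has mean zero on the ball, the constant `k x c` may be subtracted.
    have e : kernelOp k b x = ∫ y in Metric.ball c ρ, (k x y - k x c) • b y ∂(gauss n) := by
      have hc : Integrable (fun y => k x c • b y) ((gauss n).restrict (Metric.ball c ρ)) :=
        hb.integrable.restrict.smul (k x c)
      simp_rw [sub_smul]
      rw [integral_sub hx.restrict hc, integral_smul, hb.cancel,
        smul_zero, sub_zero, hrep]
    rw [e]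
    refine (enorm_integral_le_lintegral_enorm _).trans_eq ?_
    simp_rw [enorm_smul]

theorem exists_atom_le (hn : 1 ≤ n) (hk : FracKernel β k) (hβ0 : 0 < β) (hβ1 : β < 1)
    {r : ℝ} (hr : 1 < r) :
    ∃ C : ℝ≥0, ∀ b : E n → ℂ, IsAtom r b → Integrable b (gauss n) ∧
      eLpNorm (kernelOp k b) (ENNReal.ofReal (1 / (1 - β))) (gauss n) ≤ C := by
  have h1β : 0 < 1 - β := by linarith
  have hq0 : 0 < 1 / (1 - β) := by positivity
  obtain ⟨C₁, hC₁, h₁⟩ := hk.exists_ballAtom_le hn hβ0 hβ1 hr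
  obtain ⟨C₂, hC₂, h₂⟩ := hk.exists_lintegral_le hn hβ0
  set D : ℝ≥0∞ := (ENNReal.ofReal C₂ ^ (1 / (1 - β)) * gauss n Set.univ) ^ (1 - β) with hD
  have hDt : D ≠ ∞ := by finiteness
  refine ⟨C₁.toNNReal + D.toNNReal, fun b hb => ?_⟩
  rw [ENNReal.coe_add, ENNReal.coe_toNNReal hDt]
  rcases hb with hb | ⟨hbi, c, ρ, hadm, hsupp, hsize, hcancel⟩
  · refine ⟨(integrable_const (1 : ℂ)).congr hb.symm, le_add_left ?_⟩
    rw [eLpNorm_ofReal_one_div h1β]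
    refine ENNReal.rpow_le_rpow ?_ h1β.le
    refine (lintegral_mono fun x => ?_).trans_eq (lintegral_const _)
    refine ENNReal.rpow_le_rpow ?_ hq0.le
    refine (enorm_integral_le_lintegral_enorm _).trans (le_trans (le_of_eq ?_) (h₂ x))
    refine lintegral_congr_ae ?_
    filter_upwards [hb] with y hy
    rw [hk.enorm_smul_eq, hy]
    simp
  · exact ⟨hbi, le_add_right (h₁ b c ρ ⟨hbi, hadm, hsupp, hsize, hcancel⟩)⟩

/-- Partial sums converge in `L¹`, so by the `L¹` bound their images converge to `kernelOp k f` in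
`L¹`, hence almost everywhere along a subsequence. Fatou gives the bound for each decomposition, and
the infimum is taken last. -/
theorem exists_kernelOp_h1_le (hn : 1 ≤ n) (hk : FracKernel β k) (hβ0 : 0 < β) (hβ1 : β < 1)
    {r : ℝ} (hr : 1 < r) :
    ∃ C : ℝ≥0, ∀ f : E n → ℂ, MemH1 r f →
      MemLp (kernelOp k f) (ENNReal.ofReal (1 / (1 - β))) (gauss n) ∧
      eLpNorm (kernelOp k f) (ENNReal.ofReal (1 / (1 - β))) (gauss n) ≤ C * h1Norm r f := by
  have h1β : 0 < 1 - β := by linarith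
  obtain ⟨C₁, h₁⟩ := hk.exists_atom_le hn hβ0 hβ1 hr
  obtain ⟨C₂, hC₂, h₂⟩ := hk.exists_kernelOp_integrable hn hβ0 ℂ
  -- The constant must be nonzero to pass through the infimum in `ℝ≥0∞`.
  refine ⟨C₁ + 1, fun f hf => ?_⟩
  set q := ENNReal.ofReal (1 / (1 - β)) with hq
  have hq1 : 1 ≤ q := by
    rw [hq, ENNReal.one_le_ofReal, le_div_iff₀ h1β]; linarith
  obtain ⟨hfi, hdec⟩ := hf
  obtain ⟨hi, hT, -⟩ := h₂ f hfi
  have key : ∀ lam b, IsAtomicDecomposition r f lam b →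
      eLpNorm (kernelOp k f) q (gauss n) ≤ (C₁ + 1 : ℝ≥0) * ∑' j, ‖lam j‖ₑ := by
    rintro lam b ⟨hb, -, hlim⟩
    have hbi : ∀ j, Integrable (b j) (gauss n) := fun j => (h₁ _ (hb j)).1
    have hint : ∀ᵐ x ∂(gauss n), ∀ j, Integrable (fun y => k x y • b j y) (gauss n) :=
      ae_all_iff.mpr fun j => (h₂ _ (hbi j)).1
    set S : ℕ → E n → ℂ := fun N x => ∑ j ∈ Finset.range N, lam j * kernelOp k (b j) x with hS
    have hSi : ∀ N, Integrable (S N) (gauss n) := fun N =>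
      integrable_finsetSum _ fun j _ => ((h₂ _ (hbi j)).2.1.const_mul (lam j))
    have hsumi : ∀ N, Integrable (fun y => ∑ j ∈ Finset.range N, lam j * b j y) (gauss n) :=
      fun N => integrable_finsetSum _ fun j _ => ((hbi j).const_mul (lam j))
    have hdiff : ∀ N, kernelOp k (fun x => f x - ∑ j ∈ Finset.range N, lam j * b j x)
        =ᵐ[gauss n] kernelOp k f - S N := by
      intro N
      filter_upwards [hi, hint] with x hx hxb
      have hxb' : ∀ j, Integrable (fun y => lam j * k x y • b j y) (gauss n) :=
        fun j => (hxb j).const_mul _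
      simp only [kernelOp, Pi.sub_apply, hS, smul_sub, Finset.smul_sum, ← mul_smul_comm]
      rw [integral_sub hx (integrable_finsetSum _ fun j _ => hxb' j),
        integral_finsetSum _ fun j _ => hxb' j]
      simp_rw [integral_const_mul]
    have hSlim : Tendsto (fun N => eLpNorm (S N - kernelOp k f) 1 (gauss n)) atTop (𝓝 0) := by
      have h3 := ENNReal.Tendsto.const_mul (a := ENNReal.ofReal C₂) hlim
        (Or.inr ENNReal.ofReal_ne_top)
      rw [mul_zero] at h3
      refine tendsto_of_tendsto_of_tendsto_of_le_of_le tendsto_const_nhds h3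
        (fun _ => zero_le) fun N => ?_
      simp only
      rw [eLpNorm_sub_comm, ← eLpNorm_congr_ae (hdiff N)]
      exact (h₂ _ (hfi.sub (hsumi N))).2.2
    obtain ⟨ns, -, hns⟩ := (tendstoInMeasure_of_tendsto_eLpNorm one_ne_zero
      (fun N => (hSi N).1) hT.1 hSlim).exists_seq_tendsto_ae
    refine (Lp.eLpNorm_lim_le_liminf_eLpNorm (p := q) (fun N => (hSi (ns N)).1) _ hns).trans ?_
    refine (liminf_le_liminf (v := fun _ => (C₁ + 1 : ℝ≥0) * ∑' j, ‖lam j‖ₑ)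
      (Eventually.of_forall fun N => ?_)).trans_eq (liminf_const _)
    have hSeq : S (ns N) = ∑ j ∈ Finset.range (ns N), lam j • kernelOp k (b j) := by
      ext x
      simp [hS, Finset.sum_apply]
    rw [hSeq]
    refine (eLpNorm_sum_le (fun j _ => ((h₂ _ (hbi j)).2.1.1.const_smul _)) hq1).trans ?_
    calc _ ≤ ∑ j ∈ Finset.range (ns N), (C₁ + 1 : ℝ≥0) * ‖lam j‖ₑ := by
          refine Finset.sum_le_sum fun j _ => ?_
          rw [eLpNorm_const_smul, mul_comm]
          gcongr
          refine (h₁ _ (hb j)).2.trans ?_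
          exact_mod_cast le_self_add
      _ ≤ _ := by
          rw [← Finset.mul_sum]
          gcongr
          exact ENNReal.sum_le_tsum _
  refine ⟨⟨hT.1, ?_⟩, ?_⟩
  · obtain ⟨lam, b, hd⟩ := hdec
    refine (key lam b hd).trans_lt (ENNReal.mul_lt_top ENNReal.coe_lt_top ?_)
    exact (tsum_enorm_ne_top_iff_summable_norm.mpr hd.2.1).lt_top
  · have h0 : ((C₁ + 1 : ℝ≥0) : ℝ≥0∞) ≠ 0 := by positivity
    rw [h1Norm]
    simp_rw [ENNReal.mul_iInf_of_ne h0 ENNReal.coe_ne_top]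
    exact le_iInf fun lam => le_iInf fun b => le_iInf fun hd => key lam b hd

end FracKernel

/-! ### From local volumes to fractional kernels -/

/-- Functions `W(x, y)` that are locally at least of the size `e^{-|x|²} |x - y|ⁿ` and vary
slowly away from the diagonal. -/
structure LocalVolume (W : E n → E n → ℝ) : Prop where
  measurable : Measurable (Function.uncurry W)
  nonneg : ∀ x y, 0 ≤ W x y
  self : ∀ x, W x x = 0
  size : ∀ A, 0 < A → ∃ κ, 0 < κ ∧ ∀ x y, dist x y ≤ A * m x → κ * (wt x * dist x y ^ n) ≤ W x y
  reg : ∀ A, 0 < A → ∃ C, 0 < C ∧ ∀ x y x' y', 0 < dist x y → dist x y ≤ A * m x →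
    4 * (dist x x' + dist y y') ≤ dist x y →
    W x' y' ≤ (1 + C * ((dist x x' + dist y y') / dist x y)) * W x y

open Classical in
/-- The kernel `W^{-(1-β)}`, cut off at the scale `a m(x)`. -/
def localKernel (a β : ℝ) (W : E n → E n → ℝ) (x y : E n) : ℝ :=
  if dist y x < a * m x then 1 / W x y ^ (1 - β) else 0

namespace LocalVolume

variable {W : E n → E n → ℝ} {a β : ℝ}

theorem localKernel_nonneg (hW : LocalVolume W) (x y : E n) : 0 ≤ localKernel a β W x y := by
  unfold localKernel
  split_ifs
  · exact div_nonneg zero_le_one (Real.rpow_nonneg (hW.nonneg x y) _)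
  · exact le_rfl

theorem measurable_localKernel (hW : LocalVolume W) :
    Measurable (Function.uncurry (localKernel a β W)) := by
  refine Measurable.ite ?_ (measurable_const.div (hW.measurable.pow_const _)) measurable_const
  exact measurableSet_lt (by fun_prop) ((measurable_m.comp measurable_fst).const_mul a)

theorem dist_lt_of_localKernel_ne_zero {x y : E n} (h : localKernel a β W x y ≠ 0) :
    dist x y < a * m x := by
  unfold localKernel at h
  rw [dist_comm]
  by_contra h0
  exact h (if_neg h0)

theorem exists_localKernel_le (hW : LocalVolume W) (ha : 0 < a) (hβ1 : β < 1) {A : ℝ}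
    (hA : 0 < A) :
    ∃ C, 0 < C ∧ ∀ c x y : E n, dist x c ≤ A * m c →
      localKernel a β W x y ≤ C * (wt c * dist x y ^ n) ^ (-(1 - β)) := by
  have h1β : 0 < 1 - β := by linarith
  obtain ⟨κ, hκ, h⟩ := hW.size a ha
  have hw := wtConst_pos A
  refine ⟨(κ / wtConst A) ^ (-(1 - β)), by positivity, fun c x y hx => ?_⟩
  have hwc := wt_pos c
  by_cases h0 : localKernel a β W x y = 0
  · rw [h0]; positivity
  have hd := dist_lt_of_localKernel_ne_zero h0
  have hd' : dist y x < a * m x := by rwa [dist_comm]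
  rw [localKernel, if_pos hd'] at h0 ⊢
  -- On the diagonal `W = 0`, and the convention `1 / 0 = 0` makes the kernel vanish there.
  have hxy : 0 < dist x y := by
    refine dist_pos.mpr fun hxy => h0 ?_
    rw [hxy, hW.self, Real.zero_rpow h1β.ne', div_zero]
  have hwt : wt c ≤ wtConst A * wt x := wt_le_of_dist hA.le (by rwa [dist_comm])
  have h1 : κ / wtConst A * (wt c * dist x y ^ n) ≤ W x y := by
    refine le_trans ?_ (h x y hd.le)
    rw [div_mul_eq_mul_div, div_le_iff₀ hw]
    calc κ * (wt c * dist x y ^ n) ≤ κ * (wtConst A * wt x * dist x y ^ n) := by gcongr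
      _ = _ := by ring
  rw [← Real.mul_rpow (by positivity) (by positivity), one_div, ← Real.rpow_neg (hW.nonneg x y)]
  exact Real.rpow_le_rpow_of_nonpos (by positivity) h1 (by linarith)

theorem one_sub_inv_rpow_le {u s : ℝ} (hu : 0 ≤ u) (hs : s ≤ 1) :
    1 - 1 / (1 + u) ^ s ≤ u := by
  have h1 : (1 + u) ^ s ≤ 1 + u := by
    calc (1 + u) ^ s ≤ (1 + u) ^ (1 : ℝ) := Real.rpow_le_rpow_of_exponent_le (by linarith) hs
      _ = 1 + u := Real.rpow_one _
  have h0 : 0 < (1 + u) ^ s := Real.rpow_pos_of_pos (by linarith) _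
  have h2 : 1 / (1 + u) ≤ 1 / (1 + u) ^ s := one_div_le_one_div_of_le h0 h1
  have h3 : 1 - u ≤ 1 / (1 + u) := by
    rw [le_div_iff₀ (by linarith)]; nlinarith
  linarith

/-- A one-sided bound suffices, as the two points can later be exchanged. If the second pair is
inside the cut-off, the regularity of `W` gives a relative change `O(η)`. If it is outside, then
`dist x y` is at least a multiple of `m c`, and the size of the kernel alone gives the second term.
-/
theorem exists_localKernel_sub_le (hW : LocalVolume W) (ha : 0 < a) (hβ0 : 0 < β) (hβ1 : β < 1)
    {A : ℝ} (hA : 0 < A) :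
    ∃ C, 0 < C ∧ ∀ c x y x' y' : E n, 0 < dist x y → dist x c ≤ A * m c →
      4 * (dist x x' + dist y y') ≤ dist x y →
      localKernel a β W x y - localKernel a β W x' y' ≤
        C * (wt c ^ (-(1 - β)) * ((dist x x' + dist y y') / dist x y *
          (dist x y ^ n) ^ (-(1 - β)) + (m c ^ n) ^ (-(1 - β)))) := by
  have h1β : 0 < 1 - β := by linarith
  obtain ⟨C₀, hC₀, h₀⟩ := hW.exists_localKernel_le ha hβ1 hA
  obtain ⟨κ, hκ, hsize⟩ := hW.size a ha
  obtain ⟨C₁, hC₁, h₁⟩ := hW.reg a ha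
  -- From `m c ≤ (1 + A) * m x`, `m x ≤ (1 + a) * m x'` and `a * m x' ≤ dist x' y' ≤ (5 / 4) * dist
  -- x y`.
  set L := (1 + A) * ((1 + a) * (5 / (4 * a))) with hL
  have hL0 : 0 < L := by positivity
  refine ⟨C₀ * (C₁ + (L ^ n) ^ (1 - β)), by positivity, fun c x y x' y' hd hxc h4 => ?_⟩
  have hwc := wt_pos c
  have hm := m_pos c
  have hk' := hW.localKernel_nonneg (a := a) (β := β) x' y'
  set η := (dist x x' + dist y y') / dist x y with hη
  have hη0 : 0 ≤ η := by positivity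
  set u := η * (dist x y ^ n) ^ (-(1 - β)) with hu
  set v := (m c ^ n) ^ (-(1 - β)) with hv
  have hu0 : 0 ≤ u := by positivity
  have hv0 : 0 ≤ v := by positivity
  have hwp : 0 < wt c ^ (-(1 - β)) := by positivity
  have hLp : 0 < (L ^ n) ^ (1 - β) := by positivity
  by_cases hk0 : localKernel a β W x y = 0
  · rw [hk0]
    have : 0 ≤ C₀ * (C₁ + (L ^ n) ^ (1 - β)) * (wt c ^ (-(1 - β)) * (u + v)) := by positivity
    linarith
  have hda := dist_lt_of_localKernel_ne_zero hk0
  have hda' : dist y x < a * m x := by rwa [dist_comm]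
  have hsz := h₀ c x y hxc
  rw [Real.mul_rpow hwc.le (by positivity)] at hsz
  set K := localKernel a β W x y with hK
  have hK0 : 0 ≤ K := hW.localKernel_nonneg x y
  have hKeq : K = 1 / W x y ^ (1 - β) := by rw [hK, localKernel, if_pos hda']
  have hWpos : 0 < W x y := lt_of_lt_of_le (by have := wt_pos x; positivity) (hsize x y hda.le)
  have htri : |dist x y - dist x' y'| ≤ dist x x' + dist y y' := by
    have := dist_dist_dist_le x y x' y'
    rwa [Real.dist_eq] at this
  rw [abs_le] at htri
  have hyy := dist_nonneg (x := y) (y := y')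
  by_cases hy' : dist y' x' < a * m x'
  · have hW' : W x' y' ≤ (1 + C₁ * η) * W x y := h₁ x y x' y' hd hda.le h4
    have hW'pos : 0 < W x' y' := by
      refine lt_of_lt_of_le ?_ (hsize x' y' (by rw [dist_comm]; exact hy'.le))
      have := wt_pos x'
      have : 0 < dist x' y' := by linarith [htri.1, htri.2]
      positivity
    have hk'eq : localKernel a β W x' y' = 1 / W x' y' ^ (1 - β) := by
      rw [localKernel, if_pos hy']
    have h5 : K * (1 / (1 + C₁ * η) ^ (1 - β)) ≤ localKernel a β W x' y' := by
      rw [hk'eq, hKeq, one_div_mul_one_div, ← Real.mul_rpow hWpos.le (by positivity)]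
      refine one_div_le_one_div_of_le (by positivity) ?_
      exact Real.rpow_le_rpow hW'pos.le (by linarith) h1β.le
    have h6 : 1 - 1 / (1 + C₁ * η) ^ (1 - β) ≤ C₁ * η :=
      one_sub_inv_rpow_le (by positivity) (by linarith)
    calc K - localKernel a β W x' y' ≤ K * (1 - 1 / (1 + C₁ * η) ^ (1 - β)) := by linarith
      _ ≤ K * (C₁ * η) := by gcongr
      _ ≤ C₀ * (wt c ^ (-(1 - β)) * (dist x y ^ n) ^ (-(1 - β))) * (C₁ * η) := by gcongr
      _ = C₀ * C₁ * (wt c ^ (-(1 - β)) * u) := by rw [hu]; ring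
      _ ≤ C₀ * (C₁ + (L ^ n) ^ (1 - β)) * (wt c ^ (-(1 - β)) * (u + v)) := by
          gcongr <;> linarith
  · push Not at hy'
    rw [dist_comm] at hy'
    have h5 : m x ≤ (1 + a) * m x' := m_le_of_dist ha.le (by linarith)
    have h6 : m c ≤ (1 + A) * m x := m_le_of_dist hA.le (by rwa [dist_comm])
    have h7 : m x' ≤ 5 / (4 * a) * dist x y := by
      rw [div_mul_eq_mul_div, le_div_iff₀ (by positivity)]
      linarith [htri.1, htri.2]
    have h8 : m c ≤ L * dist x y := by
      calc m c ≤ (1 + A) * m x := h6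
        _ ≤ (1 + A) * ((1 + a) * m x') := by gcongr
        _ ≤ (1 + A) * ((1 + a) * (5 / (4 * a) * dist x y)) := by gcongr
        _ = _ := by rw [hL]; ring
    have h9 : (dist x y ^ n) ^ (-(1 - β)) ≤ (L ^ n) ^ (1 - β) * v := by
      have e : (L ^ n) ^ (1 - β) = ((L ^ n)⁻¹) ^ (-(1 - β)) := by
        rw [Real.inv_rpow (by positivity), Real.rpow_neg (by positivity), inv_inv]
      rw [e, hv, ← Real.mul_rpow (by positivity) (by positivity)]
      refine Real.rpow_le_rpow_of_nonpos (by positivity) ?_ (by linarith)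
      rw [inv_mul_le_iff₀ (by positivity), ← mul_pow]
      gcongr
    calc K - localKernel a β W x' y' ≤ K := by linarith
      _ ≤ C₀ * (wt c ^ (-(1 - β)) * (dist x y ^ n) ^ (-(1 - β))) := hsz
      _ ≤ C₀ * (wt c ^ (-(1 - β)) * ((L ^ n) ^ (1 - β) * v)) := by gcongr
      _ = C₀ * (L ^ n) ^ (1 - β) * (wt c ^ (-(1 - β)) * v) := by ring
      _ ≤ C₀ * (C₁ + (L ^ n) ^ (1 - β)) * (wt c ^ (-(1 - β)) * (u + v)) := by
          gcongr <;> linarith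

/-- Passage from the distance `d` to the comparable distance `D`. -/
theorem osc_bound_le (hβ1 : β < 1) {d D δ r w v : ℝ} (hd : D / 2 ≤ d) (hD : 0 < D)
    (hr : 0 ≤ r) (hδ : δ ≤ 2 * r) (hw : 0 ≤ w) (hv : 0 ≤ v) :
    w * (δ / d * (d ^ n) ^ (-(1 - β)) + v) ≤
      4 * (2 ^ n) ^ (1 - β) * (w * (r / D * (D ^ n) ^ (-(1 - β)) + v)) := by
  have h1β : 0 < 1 - β := by linarith
  have hd0 : 0 < d := by linarith
  have h1 : δ / d ≤ 4 * (r / D) := by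
    rw [← mul_div_assoc, div_le_div_iff₀ hd0 hD]
    nlinarith
  have h2 : (d ^ n) ^ (-(1 - β)) ≤ (2 ^ n) ^ (1 - β) * (D ^ n) ^ (-(1 - β)) := by
    have e : ((2 : ℝ) ^ n) ^ (1 - β) = (((2 : ℝ) ^ n)⁻¹) ^ (-(1 - β)) := by
      rw [Real.inv_rpow (by positivity), Real.rpow_neg (by positivity), inv_inv]
    rw [e, ← Real.mul_rpow (by positivity) (by positivity)]
    refine Real.rpow_le_rpow_of_nonpos (by positivity) ?_ (by linarith)
    rw [inv_mul_le_iff₀ (by positivity), ← mul_pow]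
    gcongr
    linarith
  have h3 : (1 : ℝ) ≤ 4 * (2 ^ n) ^ (1 - β) := by
    have : (1 : ℝ) ≤ (2 ^ n) ^ (1 - β) :=
      Real.one_le_rpow (one_le_pow₀ (by norm_num)) h1β.le
    linarith
  calc w * (δ / d * (d ^ n) ^ (-(1 - β)) + v)
      ≤ w * (4 * (r / D) * ((2 ^ n) ^ (1 - β) * (D ^ n) ^ (-(1 - β))) +
        4 * (2 ^ n) ^ (1 - β) * v) := by
        gcongr
        exact le_mul_of_one_le_left hv h3
    _ = _ := by ring

theorem fracKernel (hW : LocalVolume W) (ha : 0 < a) (hβ0 : 0 < β) (hβ1 : β < 1) :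
    FracKernel β (localKernel a β W) where
  measurable := hW.measurable_localKernel
  nonneg := hW.localKernel_nonneg
  supp := by
    refine ⟨a * (1 + a), by positivity, fun x y hxy => ?_⟩
    have h1 := dist_lt_of_localKernel_ne_zero hxy
    have h2 : m x ≤ (1 + a) * m y := m_le_of_dist ha.le h1.le
    have h3 := m_pos x
    constructor
    · nlinarith [mul_pos ha (mul_pos ha h3)]
    · nlinarith
  size A hA := by
    obtain ⟨C, hC, h⟩ := hW.exists_localKernel_le ha hβ1 hA
    exact ⟨C, hC, fun c x y hx _ => h c x y hx⟩
  osc_left A hA := by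
    obtain ⟨C, hC, h⟩ := hW.exists_localKernel_sub_le ha hβ0 hβ1 hA
    refine ⟨C * (4 * (2 ^ n) ^ (1 - β)), by positivity, fun c r hr hrA x x' y hx hx' hy => ?_⟩
    have hwc := wt_pos c
    have hm := m_pos c
    have key : ∀ z z' : E n, dist z c < r → dist z' c < r →
        localKernel a β W z y - localKernel a β W z' y ≤
        C * (4 * (2 ^ n) ^ (1 - β)) * (wt c ^ (-(1 - β)) *
          (r / dist y c * (dist y c ^ n) ^ (-(1 - β)) + (m c ^ n) ^ (-(1 - β)))) := by
      intro z z' hz hz'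
      have h1 := dist_triangle_left y c z
      have h2 := dist_triangle_right z z' c
      -- The factor nine enters here: `dist z y ≥ 8 * r` while `dist z z' < 2 * r`.
      have h3 := h c z y z' y (by linarith) (by linarith) (by rw [dist_self]; linarith)
      rw [dist_self, add_zero] at h3
      refine h3.trans ?_
      rw [mul_assoc C]
      refine mul_le_mul_of_nonneg_left (osc_bound_le hβ1 ?_ ?_ hr.le ?_ ?_ ?_) hC.le
      · linarith
      · linarith
      · linarith
      · positivity
      · positivity
    rw [abs_sub_le_iff]
    exact ⟨key x x' hx hx', key x' x hx' hx⟩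
  osc_right A hA := by
    -- The point `y` is now the first variable and need not be near `c`. But the difference can be
    -- positive only if `k y z ≠ 0`, and then `y` lies within this multiple of `m c` of `c`.
    obtain ⟨C, hC, h⟩ := hW.exists_localKernel_sub_le (A := A + a * (1 + a) * (1 + A))
      ha hβ0 hβ1 (by positivity)
    refine ⟨C * (4 * (2 ^ n) ^ (1 - β)), by positivity, fun c r hr hrA x x' y hx hx' hy => ?_⟩
    have hwc := wt_pos c
    have hm := m_pos c
    have key : ∀ z z' : E n, dist z c < r → dist z' c < r →
        localKernel a β W y z - localKernel a β W y z' ≤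
        C * (4 * (2 ^ n) ^ (1 - β)) * (wt c ^ (-(1 - β)) *
          (r / dist y c * (dist y c ^ n) ^ (-(1 - β)) + (m c ^ n) ^ (-(1 - β)))) := by
      intro z z' hz hz'
      by_cases hk0 : localKernel a β W y z = 0
      · rw [hk0, zero_sub]
        refine (neg_nonpos.mpr (hW.localKernel_nonneg _ _)).trans ?_
        have : 0 < dist y c := by linarith
        positivity
      have hyz := dist_lt_of_localKernel_ne_zero hk0
      have h4 : m y ≤ (1 + a) * m z := m_le_of_dist ha.le hyz.le
      have h5 : m z ≤ (1 + A) * m c := m_le_of_dist' hA.le (by rw [dist_comm]; linarith)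
      have h6 : a * m y ≤ a * ((1 + a) * ((1 + A) * m c)) := by
        have : m y ≤ (1 + a) * ((1 + A) * m c) := h4.trans (by gcongr)
        gcongr
      have h1 := dist_triangle y z c
      have h2 := dist_triangle_right z z' c
      have h7 : dist y c ≤ (A + a * (1 + a) * (1 + A)) * m c := by nlinarith
      have h3 := h c y z y z' (by linarith) h7 (by rw [dist_self]; linarith)
      rw [dist_self, zero_add] at h3
      refine h3.trans ?_
      rw [mul_assoc C]
      refine mul_le_mul_of_nonneg_left (osc_bound_le hβ1 ?_ ?_ hr.le ?_ ?_ ?_) hC.le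
      · linarith
      · linarith
      · linarith
      · positivity
      · positivity
    rw [abs_sub_le_iff]
    exact ⟨key x x' hx hx', key x' x hx' hx⟩

end LocalVolume

/-! ### The two kernels of the theorem -/

/-- Multiplying `1 - L * η ≤ exp (-(L * η))` by `exp (L * η)` gives the linear bound. It turns the
exponential factors of the regularity estimates into `1 + C * η`. -/
theorem exp_mul_le_one_add {L η : ℝ} (hL : 0 ≤ L) (hη0 : 0 ≤ η) (hη1 : η ≤ 1) :
    Real.exp (L * η) ≤ 1 + L * Real.exp L * η := by
  have h1 : 1 - L * η ≤ Real.exp (-(L * η)) := by linarith [Real.add_one_le_exp (-(L * η))]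
  have h2 : Real.exp (-(L * η)) * Real.exp (L * η) = 1 := by rw [← Real.exp_add]; simp
  have h3 : Real.exp (L * η) ≤ Real.exp L := Real.exp_le_exp.mpr (by nlinarith)
  have h4 : 0 ≤ L * η := by positivity
  have h5 := mul_le_mul_of_nonneg_right h1 (Real.exp_pos (L * η)).le
  have h6 := mul_le_mul_of_nonneg_left h3 h4
  nlinarith

theorem one_add_mul_pow_le {s η : ℝ} (hs : 0 ≤ s) (hη0 : 0 ≤ η) :
    (1 + s * η) ^ n ≤ Real.exp (n * s * η) := by
  calc (1 + s * η) ^ n ≤ Real.exp (s * η) ^ n := by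
        gcongr
        linarith [Real.add_one_le_exp (s * η)]
    _ = _ := by rw [← Real.exp_nat_mul]; ring_nf

theorem localVolume_wt_mul_dist_pow (hn : 1 ≤ n) :
    LocalVolume (fun x y : E n => wt x * dist x y ^ n) where
  measurable := (measurable_wt.comp measurable_fst).mul (measurable_dist.pow_const n)
  nonneg x y := by have := wt_pos x; positivity
  self x := by rw [dist_self, zero_pow (by omega), mul_zero]
  size A hA := ⟨1, one_pos, fun x y _ => by rw [one_mul]⟩
  reg A hA := by
    set L : ℝ := 2 * A + A ^ 2 + n with hL
    have hL0 : 0 < L := by positivity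
    refine ⟨L * Real.exp L, by positivity, fun x y x' y' hd hdA h4 => ?_⟩
    set η := (dist x x' + dist y y') / dist x y with hη
    have hη0 : 0 ≤ η := by positivity
    have hη1 : η ≤ 1 := by
      rw [hη, div_le_one hd]
      linarith [dist_nonneg (x := x) (y := x'), dist_nonneg (x := y) (y := y')]
    have hηd : η * dist x y = dist x x' + dist y y' := div_mul_cancel₀ _ hd.ne'
    have hx := wt_pos x
    have hm := m_pos x
    have hdx' : dist x x' ≤ η * dist x y := by
      rw [hηd]; linarith [dist_nonneg (x := y) (y := y')]
    have hdx : dist x x' ≤ dist x y := by nlinarith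
    -- The displacement is at most `η * (A * m x)`, so the change of `|x|²` keeps the factor `η`.
    have h1 : wt x' ≤ Real.exp ((2 * A + A ^ 2) * η) * wt x := by
      rw [wt, wt, ← Real.exp_add]
      apply Real.exp_le_exp.mpr
      have h2 := (abs_le.mp (abs_norm_sq_sub_le x x')).2
      have h3 : dist x x' * (2 * ‖x‖ + dist x x') ≤ (η * (A * m x)) * (2 * ‖x‖ + A * m x) := by
        gcongr
        · exact hdx'.trans (by gcongr)
        · linarith
      have h5 : (η * (A * m x)) * (2 * ‖x‖ + A * m x) =
          η * (2 * A * (‖x‖ * m x) + A ^ 2 * (m x * m x)) := by ring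
      have h6 : η * (2 * A * (‖x‖ * m x) + A ^ 2 * (m x * m x)) ≤
          η * (2 * A * 1 + A ^ 2 * (1 * 1)) := by
        have h7 := m_le_one x
        have h8 := norm_mul_m_le x
        gcongr
      linarith
    have h2 : dist x' y' ≤ (1 + 1 * η) * dist x y := by
      have h5 := dist_dist_dist_le x y x' y'
      rw [Real.dist_eq, abs_le] at h5
      linarith [h5.1]
    calc wt x' * dist x' y' ^ n
        ≤ (Real.exp ((2 * A + A ^ 2) * η) * wt x) * ((1 + 1 * η) * dist x y) ^ n := by gcongr
      _ = Real.exp ((2 * A + A ^ 2) * η) * (1 + 1 * η) ^ n * (wt x * dist x y ^ n) := by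
          rw [mul_pow]; ring
      _ ≤ Real.exp ((2 * A + A ^ 2) * η) * Real.exp (n * 1 * η) * (wt x * dist x y ^ n) := by
          gcongr
          exact one_add_mul_pow_le zero_le_one hη0
      _ = Real.exp (L * η) * (wt x * dist x y ^ n) := by
          rw [← Real.exp_add, hL]; ring_nf
      _ ≤ _ := by
          gcongr
          exact exp_mul_le_one_add hL0.le hη0 hη1

theorem measurable_V : Measurable (Function.uncurry (V : E n → E n → ℝ)) := by
  have hs : MeasurableSet {p : (E n × E n) × E n | dist p.2 p.1.1 < ‖p.1.1 - p.1.2‖} :=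
    measurableSet_lt (by fun_prop) (by fun_prop)
  exact (measurable_measure_prodMk_left (ν := gauss n) hs).ennreal_toReal

theorem localVolume_V (hn : 1 ≤ n) : LocalVolume (V : E n → E n → ℝ) where
  measurable := measurable_V
  nonneg x y := measureReal_nonneg
  self x := by simp [V]
  size A hA := by
    have hg := gaussConst_pos n
    have hw := wtConst_pos A
    have hu := unitVol_pos (n := n)
    refine ⟨gaussConst n / wtConst A * unitVol n, by positivity, fun x y h => ?_⟩
    rcases (dist_nonneg (x := x) (y := y)).eq_or_lt with h0 | h0
    · rw [← h0, zero_pow (by omega), mul_zero, mul_zero]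
      exact measureReal_nonneg
    · have hx := wt_pos x
      rw [V, ← dist_eq_norm, Measure.real, ← ENNReal.ofReal_le_iff_le_toReal (measure_ne_top _ _)]
      exact le_gauss_ball hA.le h0 h
  reg A hA := by
    have hg := gaussConst_pos n
    have hw := wtConst_pos A
    have hw2 := wtConst_pos (2 * A)
    have hu := unitVol_pos (n := n)
    set κ₁ := gaussConst n / wtConst A * unitVol n with hκ₁
    set κ₂ := gaussConst n * wtConst (2 * A) * unitVol n with hκ₂
    have hκ₁0 : 0 < κ₁ := by positivity
    have hκ₂0 : 0 < κ₂ := by positivity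
    set L : ℝ := n * 2 with hL
    have hL0 : 0 < L := by
      have : (0 : ℝ) < n := by exact_mod_cast hn
      positivity
    refine ⟨κ₂ * (L * Real.exp L) / κ₁, by positivity, fun x y x' y' hd hdA h4 => ?_⟩
    set η := (dist x x' + dist y y') / dist x y with hη
    have hη0 : 0 ≤ η := by positivity
    have hη1 : η ≤ 1 / 4 := by
      rw [hη, div_le_iff₀ hd]; linarith
    have hηd : η * dist x y = dist x x' + dist y y' := div_mul_cancel₀ _ hd.ne'
    have hx := wt_pos x
    -- The ball about `x'` of radius `dist x' y'` lies in the ball about `x` of radius `dist x' y' +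
    -- dist x x'`, which is at most `s`. The annulus of radii `dist x y` and `s` has measure `O(η) *
    -- V x y`.
    set s := (1 + 2 * η) * dist x y with hs
    have hds : dist x y ≤ s := by rw [hs]; nlinarith [mul_nonneg hη0 hd.le]
    have hsA : s ≤ 2 * A * m x := by
      have : s ≤ 2 * dist x y := by rw [hs]; gcongr; linarith
      linarith
    have hsub : Metric.ball x' ‖x' - y'‖ ⊆ Metric.ball x s := by
      apply Metric.ball_subset_ball'
      rw [← dist_eq_norm, dist_comm x' x]
      have h5 := dist_dist_dist_le x y x' y'
      rw [Real.dist_eq, abs_le] at h5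
      have h6 := dist_nonneg (x := y) (y := y')
      have h7 : s = dist x y + 2 * (dist x x' + dist y y') := by rw [← hηd, hs]; ring
      linarith [h5.1]
    have h1 := (measure_mono hsub).trans
      (gauss_ball_le_add (A := 2 * A) (by positivity) hd hds hsA)
    have h0 : 0 ≤ s ^ n - dist x y ^ n := sub_nonneg.mpr (by gcongr)
    have h2 : V x' y' ≤ V x y + κ₂ * (wt x * (s ^ n - dist x y ^ n)) := by
      have h3 := ENNReal.toReal_mono (by finiteness) h1
      rw [ENNReal.toReal_add (by finiteness) (by finiteness),
        ENNReal.toReal_ofReal (by positivity)] at h3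
      rw [V, V, ← dist_eq_norm x y]
      exact h3
    have h3 : s ^ n - dist x y ^ n ≤ L * Real.exp L * η * dist x y ^ n := by
      have h5 : (1 + 2 * η) ^ n ≤ 1 + L * Real.exp L * η :=
        (one_add_mul_pow_le zero_le_two hη0).trans
          (exp_mul_le_one_add hL0.le hη0 (by linarith))
      rw [hs, mul_pow]
      have h6 : 0 ≤ dist x y ^ n := by positivity
      nlinarith
    have h5 : κ₁ * (wt x * dist x y ^ n) ≤ V x y := by
      rw [V, ← dist_eq_norm, Measure.real, ← ENNReal.ofReal_le_iff_le_toReal (measure_ne_top _ _)]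
      exact le_gauss_ball hA.le hd hdA
    calc V x' y' ≤ V x y + κ₂ * (wt x * (s ^ n - dist x y ^ n)) := h2
      _ ≤ V x y + κ₂ * (wt x * (L * Real.exp L * η * dist x y ^ n)) := by gcongr
      _ = V x y + κ₂ * (L * Real.exp L) / κ₁ * η * (κ₁ * (wt x * dist x y ^ n)) := by
          field_simp
      _ ≤ V x y + κ₂ * (L * Real.exp L) / κ₁ * η * V x y := by gcongr
      _ = _ := by ring

/-! ### Identification with the operators of the statement, and conclusion -/

theorem localKernel_smul_eq_indicator {F : Type*} [NormedAddCommGroup F] [NormedSpace ℝ F]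
    (a β : ℝ) (W : E n → E n → ℝ) (f : E n → F) (x : E n) :
    (fun y => localKernel a β W x y • f y) =
      (Metric.ball x (a * m x)).indicator fun y => (1 / W x y ^ (1 - β)) • f y := by
  ext y
  by_cases h : dist y x < a * m x
  · rw [localKernel, if_pos h, Set.indicator_of_mem (by simpa using h)]
  · rw [localKernel, if_neg h, Set.indicator_of_notMem (by simpa using h), zero_smul]

theorem localOp_eq_kernelOp {F : Type*} [NormedAddCommGroup F] [NormedSpace ℝ F]
    (a β : ℝ) (W : E n → E n → ℝ) (f : E n → F) :
    localOp a (fun x y => 1 / W x y ^ (1 - β)) f = kernelOp (localKernel a β W) f := by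
  ext x
  rw [kernelOp, localKernel_smul_eq_indicator,
    integral_indicator Metric.isOpen_ball.measurableSet, localOp]

theorem localOpConverges_iff {F : Type*} [NormedAddCommGroup F] [NormedSpace ℝ F]
    (a β : ℝ) (W : E n → E n → ℝ) (f : E n → F) :
    LocalOpConverges a (fun x y => 1 / W x y ^ (1 - β)) f ↔
      ∀ᵐ x ∂(gauss n), Integrable (fun y => localKernel a β W x y • f y) (gauss n) := by
  simp_rw [localKernel_smul_eq_indicator,
    integrable_indicator_iff Metric.isOpen_ball.measurableSet]
  rfl

theorem exists_localVolume (hn : 1 ≤ n) {β : ℝ} {K : E n → E n → ℝ}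
    (hK : K = kernelI β ∨ K = kernelITilde β) :
    ∃ W, LocalVolume W ∧ K = fun x y => 1 / W x y ^ (1 - β) := by
  rcases hK with rfl | rfl
  · exact ⟨V, localVolume_V hn, rfl⟩
  · refine ⟨_, localVolume_wt_mul_dist_pow hn, ?_⟩
    ext x y
    rw [kernelITilde, wt, dist_eq_norm]

end GaussFrac

end

theorem theorem3p2 (n : ℕ) (hn : 1 ≤ n) (a : ℝ) (ha : 0 < a) (β : ℝ) (hβ0 : 0 < β) (hβ1 : β < 1)
    (K : GaussFrac.E n → GaussFrac.E n → ℝ)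
    (hK : K = GaussFrac.kernelI β ∨ K = GaussFrac.kernelITilde β) :
    (∀ r : ℝ, 1 < r → ∃ C : ℝ≥0, ∀ f : GaussFrac.E n → ℂ, GaussFrac.MemH1 r f →
      GaussFrac.LocalOpConverges a K f ∧
      MemLp (GaussFrac.localOp a K f) (ENNReal.ofReal (1 / (1 - β))) (GaussFrac.gauss n) ∧
      eLpNorm (GaussFrac.localOp a K f) (ENNReal.ofReal (1 / (1 - β))) (GaussFrac.gauss n)
        ≤ C * GaussFrac.h1Norm r f) ∧
    (∃ C : ℝ≥0, ∀ f : GaussFrac.E n → ℝ,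
      MemLp f (ENNReal.ofReal (1 / β)) (GaussFrac.gauss n) → 0 ≤ᵐ[GaussFrac.gauss n] f →
      GaussFrac.LocalOpConverges a K f ∧
      GaussFrac.MemBLO a (GaussFrac.localOp a K f) ∧
      GaussFrac.bloNorm a (GaussFrac.localOp a K f)
        ≤ C * eLpNorm f (ENNReal.ofReal (1 / β)) (GaussFrac.gauss n)) ∧
    (∃ C : ℝ≥0, ∀ f : GaussFrac.E n → ℂ,
      MemLp f (ENNReal.ofReal (1 / β)) (GaussFrac.gauss n) →
      GaussFrac.LocalOpConverges a K f ∧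
      GaussFrac.MemBMO (GaussFrac.localOp a K f) ∧
      GaussFrac.bmoNorm (GaussFrac.localOp a K f)
        ≤ C * eLpNorm f (ENNReal.ofReal (1 / β)) (GaussFrac.gauss n)) := by
  obtain ⟨W, hW, rfl⟩ := GaussFrac.exists_localVolume hn hK
  have hk := hW.fracKernel ha hβ0 hβ1
  simp_rw [GaussFrac.localOp_eq_kernelOp, GaussFrac.localOpConverges_iff]
  refine ⟨fun r hr => ?_, ?_, ?_⟩
  · obtain ⟨C, h⟩ := hk.exists_kernelOp_h1_le hn hβ0 hβ1 hr
    obtain ⟨_, _, h'⟩ := hk.exists_kernelOp_integrable hn hβ0 ℂ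
    exact ⟨C, fun f hf => ⟨(h' f hf.1).1, h f hf⟩⟩
  · obtain ⟨C, h⟩ := hk.exists_bloNorm_le hn hβ0 hβ1 ha
    obtain ⟨_, h'⟩ := hk.exists_kernelOp_memLp hn hβ0 hβ1 ℝ
    exact ⟨C, fun f hf hf0 => ⟨(h' f hf).1, h f hf hf0⟩⟩
  · obtain ⟨C, h⟩ := hk.exists_bmoNorm_le hn hβ0 hβ1
    obtain ⟨_, h'⟩ := hk.exists_kernelOp_memLp hn hβ0 hβ1 ℂ
    exact ⟨C, fun f hf => ⟨(h' f hf).1, h f hf⟩⟩
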